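/- Let $n\ge 1$ and $N\ge n+1$ be integers, and let $Q$ be the equi-oriented quiver $1\to 2\to\cdots\to n$ of type $A_n$. Let $R_{\mathbf d}$ be the affine space of complex representations of $Q$ of dimension vector $\mathbf d=(N,\dots,N)$, i.e. of tuples $(f_1,\dots,f_{n-1})$ of endomorphisms of $\mathbb C^N$, with the base change action of $G_{\mathbf d}=\mathrm{GL}_N(\mathbb C)^n$; its orbits are the isomorphism classes of representations of dimension vector $\mathbf d$. For representations $M,K$ of dimension vector $\mathbf d$, we say that $M$ degenerates to $K$, or that $K$ is a degeneration of $M$, if the (Zariski) closure of the $G_{\mathbf d}$-orbit of $M$ in $R_{\mathbf d}$ contains $K$. For $1\le i\le j\le n$ let $U_{i,j}$ be the indecomposable representation that is $\mathbb C$ at the vertices $i,\dots,j$, with identity maps between them, and $0$ elsewhere. For a tuple $\mathbf a=(a_1,\dots,a_{n-1})$ of non-negative integers with $\sum_k a_k\le N$ let $$M(\mathbf a)=U_{1,n}^{\,N-\sum_k a_k}\oplus\bigoplus_{k=1}^{n-1}\bigl(U_{1,k}\oplus U_{k+1,n}\bigr)^{a_k}.$$ Fix integers $1\le e_1\le e_2\le\cdots\le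 e_n\le N$ and put $$M^1=M(e_2-e_1,\dots,e_n-e_{n-1}),$$ $$M^2=U_{1,n}^{\,N-1-e_n+e_1}\oplus\bigoplus_{k=1}^{n-1}\bigl(U_{1,k}\oplus U_{k+1,n}\bigr)^{e_{k+1}-e_k}\oplus\bigoplus_{i=1}^nU_{i,i}.$$ For $1\le i<n$ let $\mathbf a^i$ be the tuple whose $i$-th entry is $e_{i+1}-e_i+1$ and whose other entries are $0$. For $1\le i<j\le n$ let $\mathbf a^{i,j}$ be the tuple whose $k$-th entry is $e_{k+1}-e_k+\delta_{k,i}+\delta_{k,j-1}$ for $i\le k\le j-1$ and $0$ for all other $k$ (here $\delta$ is the Kronecker symbol). Let $M$ be a representation in $R_{\mathbf d}$. 1. If $M$ degenerates to $M^2$ but not to $M^1$, then $M$ is a degeneration of $M(\mathbf a^i)$ for some $1\le i<n$. 2. If $M$ does not degenerate to $M^2$, then there are $1\le i<j\le n$ such that the entries of $\mathbf a^{i,j}$ have sum at most $N$ and $M$ is a degeneration of $M(\mathbf a^{i,j})$. -/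

import Mathlib

noncomputable section

namespace TypeA

/-- A complex representation of the equi-oriented quiver `1 → 2 → ⋯ → n` of type `A_n`, where
`n = ℓ + 1`. The vertices are the elements of `Fin (ℓ + 1)`: the vertex numbered
`v` in `1, …, n` is `v - 1`. The arrow `k : Fin ℓ` goes from `k.castSucc` to `k.succ`. -/
structure QRep (ℓ : ℕ) where
  space : Fin (ℓ + 1) → Type
  [addCommGroup : ∀ v, AddCommGroup (space v)]
  [module : ∀ v, Module ℂ (space v)]
  map : ∀ k : Fin ℓ, space k.castSucc →ₗ[ℂ] space k.succ

attribute [instance] QRep.addCommGroup QRep.module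

/-- Two representations are isomorphic. -/
def QRep.Isom {ℓ : ℕ} (A B : QRep ℓ) : Prop :=
  ∃ φ : ∀ v, A.space v ≃ₗ[ℂ] B.space v,
    ∀ (k : Fin ℓ) (x : A.space k.castSucc), φ k.succ (A.map k x) = B.map k (φ k.castSucc x)

/-- The indecomposable `U_{i,j}` (for `i ≤ j`): it is `ℂ` at the vertices `v` with `i ≤ v ≤ j`
(functions on a one-point set) and `0` at the others (functions on the empty set); the maps between
two vertices of the support are the identity, all other maps are zero. -/
def interval {ℓ : ℕ} (i j : Fin (ℓ + 1)) : QRep ℓ where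
  space v := PLift (i ≤ v ∧ v ≤ j) → ℂ
  map k :=
    { toFun := fun x _ => if h : i ≤ k.castSucc ∧ k.castSucc ≤ j then x ⟨h⟩ else 0
      map_add' := by
        intro x y
        funext _
        by_cases h : i ≤ k.castSucc ∧ k.castSucc ≤ j <;> simp [h]
      map_smul' := by
        intro c x
        funext _
        by_cases h : i ≤ k.castSucc ∧ k.castSucc ≤ j <;> simp [h] }

/-- The direct sum of a finite family of representations. -/
def directSum {ℓ : ℕ} {ι : Type} [Fintype ι] (A : ι → QRep ℓ) : QRep ℓ where
  space v := ∀ s, (A s).space v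
  map k := LinearMap.pi fun s => (A s).map k ∘ₗ LinearMap.proj s

/-- The representation `⨁_{i ≤ j} U_{i,j}^{m i j}` with multiplicities `m` (the values `m i j` with
`j < i` play no role). -/
def ofMult {ℓ : ℕ} (m : Fin (ℓ + 1) → Fin (ℓ + 1) → ℕ) : QRep ℓ :=
  directSum
    (fun s : (Σ p : {p : Fin (ℓ + 1) × Fin (ℓ + 1) // p.1 ≤ p.2}, Fin (m p.1.1 p.1.2)) =>
      interval s.1.1.1 s.1.1.2)

/-- The affine space `R_d` for `d = (N, …, N)`: tuples of `n - 1 = ℓ` endomorphisms of `ℂ^N`. -/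
abbrev RepSpace (ℓ N : ℕ) : Type := Fin ℓ → Matrix (Fin N) (Fin N) ℂ

/-- A point of `R_d` as a representation. -/
def RepSpace.toQRep {ℓ N : ℕ} (M : RepSpace ℓ N) : QRep ℓ where
  space _ := Fin N → ℂ
  map k := Matrix.mulVecLin (M k)

/-- The base change action of `G_d = GL_N × ⋯ × GL_N` (`n = ℓ + 1` factors) on `R_d`. -/
def baseChange {ℓ N : ℕ} (g : Fin (ℓ + 1) → GL (Fin N) ℂ) (M : RepSpace ℓ N) : RepSpace ℓ N :=
  fun k => (g k.succ : Matrix (Fin N) (Fin N) ℂ) * M k *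
    ((g k.castSucc)⁻¹ : GL (Fin N) ℂ)

/-- The `G_d`-orbit of a point of `R_d`. -/
def orbit {ℓ N : ℕ} (M : RepSpace ℓ N) : Set (RepSpace ℓ N) :=
  Set.range fun g : Fin (ℓ + 1) → GL (Fin N) ℂ => baseChange g M

/-- The Zariski closure of a subset of the affine space `R_d`: the common zeros of all polynomials
in the matrix entries that vanish on the subset. -/
def zariskiClosure {ℓ N : ℕ} (S : Set (RepSpace ℓ N)) : Set (RepSpace ℓ N) :=
  {K | ∀ p : MvPolynomial (Fin ℓ × Fin N × Fin N) ℂ,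
    (∀ M ∈ S, MvPolynomial.eval (fun x => M x.1 x.2.1 x.2.2) p = 0) →
      MvPolynomial.eval (fun x => K x.1 x.2.1 x.2.2) p = 0}

/-- `A` degenerates to `B` (equivalently, `B` is a degeneration of `A`): `A` and `B` are, up to
isomorphism, points of `R_d`, `d = (N, …, N)`, and the point `B` lies in the closure of the
`G_d`-orbit of the point `A`. -/
def Degenerates {ℓ : ℕ} (N : ℕ) (A B : QRep ℓ) : Prop :=
  ∃ L K : RepSpace ℓ N, L.toQRep.Isom A ∧ K.toQRep.Isom B ∧ K ∈ zariskiClosure (orbit L)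

/-- The multiplicities of `M(a)`, for `∑ a_i ≤ N`: in the numbering `1, …, n` of the vertices,
`m_{1,n} = N - ∑ a_i`, `m_{1,i} = a_i` for `i < n`, `m_{i,n} = a_{i-1}` for `i > 1`, and all other
multiplicities are `0`. -/
def multA {ℓ : ℕ} (N : ℕ) (a : Fin ℓ → ℕ) (i j : Fin (ℓ + 1)) : ℕ :=
  if hi : i = 0 then
    if hj : j = Fin.last ℓ then N - ∑ k, a k else a (j.castPred hj)
  else
    if j = Fin.last ℓ then a (i.pred hi) else 0

/-- The representation `M(a)`, for `∑ a_i ≤ N`. -/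
def repA {ℓ : ℕ} (N : ℕ) (a : Fin ℓ → ℕ) : QRep ℓ := ofMult (multA N a)

/-- The tuple `(e_2 - e_1, …, e_n - e_{n-1})`. -/
def diff {ℓ : ℕ} (e : Fin (ℓ + 1) → ℕ) (k : Fin ℓ) : ℕ := e k.succ - e k.castSucc

/-- `M^1 = M(e_2 - e_1, …, e_n - e_{n-1})`. -/
def rep1 {ℓ : ℕ} (N : ℕ) (e : Fin (ℓ + 1) → ℕ) : QRep ℓ := repA N (diff e)

/-- The multiplicities of `M^2`. In the numbering `1, …, n` of the vertices, for `n ≥ 2`: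
`m_{1,1} = e_2 - e_1 + 1`, `m_{n,n} = e_n - e_{n-1} + 1`, `m_{1,n} = N - 1 - e_n + e_1`,
`m_{1,i} = e_{i+1} - e_i`, `m_{i,n} = e_i - e_{i-1}` and `m_{i,i} = 1` for `1 < i < n`, and all
other multiplicities are `0`; for `n = 1`, `m_{1,1} = N`. -/
def mult2 {ℓ : ℕ} (N : ℕ) (e : Fin (ℓ + 1) → ℕ) (i j : Fin (ℓ + 1)) : ℕ :=
  multA (N - 1) (diff e) i j + if i = j then 1 else 0

/-- The representation `M^2`. -/
def rep2 {ℓ : ℕ} (N : ℕ) (e : Fin (ℓ + 1) → ℕ) : QRep ℓ := ofMult (mult2 N e)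

/-- The tuple `a^i`, with `i`-th entry `e_{i+1} - e_i + 1` and all other entries `0`. -/
def tupI {ℓ : ℕ} (e : Fin (ℓ + 1) → ℕ) (i : Fin ℓ) : Fin ℓ → ℕ :=
  fun k => if k = i then diff e i + 1 else 0

/-- The tuple `a^{i,j}`, `i < j`, with `k`-th entry `e_{k+1} - e_k` for `i ≤ k ≤ j - 1`, increased
by `1` for `k = i` and by `1` for `k = j - 1` (hence by `2` if `j = i + 1`), and other entries `0`. -/
def tupIJ {ℓ : ℕ} (e : Fin (ℓ + 1) → ℕ) (i j : Fin (ℓ + 1)) : Fin ℓ → ℕ :=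
  fun k =>
    if i ≤ k.castSucc ∧ k.succ ≤ j then
      diff e k + (if k.castSucc = i then 1 else 0) + (if k.succ = j then 1 else 0)
    else 0

end TypeA

end

noncomputable section
namespace TypeA

open Module Submodule

/-! Write c(p,q) for the corank of the composite map from vertex p to vertex q. For M(a) it is the
sum of the a_k over the arrows between p and q; for M^1 it is e_q - e_p, and for M^2 it is e_q - e_p
+ 1 when p < q.

The geometric input is that a point lies in the orbit closure of L as soon as its ranks are bounded
by those of L (`mem_zariskiClosure_of_rk_le`). Both points are decomposed into intervals, so that
ranks become counts of intervals. If the ranks of K are not all equal to those of L, two intervals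
of K can exchange their right ends with the ranks still bounded by those of L (`exists_exchange`). K
lies on a line whose other points all belong to the orbit of the exchanged representation
(`ChainBasis.exists_degeneration`), and induction on the total corank finishes.

The rest is numerical. Coranks of M are subadditive along the quiver (`corank_triangle`) and grow
with the interval (`corank_mono`). If M does not degenerate to M^1, some c(p,q) exceeds e_q - e_p,
so by subadditivity this already happens at a single arrow i, and M(a^i) has small enough coranks.
If M does not degenerate to M^2, some c(i,j) is at least e_j - e_i + 2; for such a pair with j - i
minimal, subadditivity bounds c from below inside [i,j] by exactly the coranks of M(a^{i,j}). -/

/-! ### Interval decompositions, with all vertex spaces inside one ambient space -/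

/-- The composite of the maps `f p, …, f (p + d - 1)`. -/
def comp {E : Type*} [AddCommGroup E] [Module ℂ E] (f : ℕ → E →ₗ[ℂ] E) (p : ℕ) : ℕ → E →ₗ[ℂ] E
  | 0 => LinearMap.id
  | d + 1 => f (p + d) ∘ₗ comp f p d

theorem comp_add {E : Type*} [AddCommGroup E] [Module ℂ E] (f : ℕ → E →ₗ[ℂ] E) (p d e : ℕ) :
    comp f p (d + e) = comp f (p + d) e ∘ₗ comp f p d := by
  induction e with
  | zero => rfl
  | succ e ih =>
    change f (p + (d + e)) ∘ₗ comp f p (d + e) = (f (p + d + e) ∘ₗ comp f (p + d) e) ∘ₗ comp f p d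
    rw [ih, Nat.add_assoc, LinearMap.comp_assoc]

theorem comp_succ_left {E : Type*} [AddCommGroup E] [Module ℂ E] (f : ℕ → E →ₗ[ℂ] E) (p d : ℕ) :
    comp f p (d + 1) = comp f (p + 1) d ∘ₗ f p := by
  rw [Nat.add_comm, comp_add]
  rfl

/-- The number of intervals `[a s, b s]` of the family with `a s ≤ p` and `q ≤ b s`. -/
def cnt {ι : Type*} [Fintype ι] (a b : ι → ℕ) (p q : ℕ) : ℕ :=
  (Finset.univ.filter fun s => a s ≤ p ∧ q ≤ b s).card

/-- A decomposition into intervals of the representation with spaces `W v` and maps `f v`: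
the vectors `x s v` with `a s ≤ v ≤ b s` form a basis of the interval summand `s`. -/
structure ChainBasis {E : Type*} [AddCommGroup E] [Module ℂ E] (f : ℕ → E →ₗ[ℂ] E)
    (W : ℕ → Submodule ℂ E) {ι : Type*} [Fintype ι] (a b : ι → ℕ) (x : ι → ℕ → E) : Prop where
  zero : ∀ s v, ¬ (a s ≤ v ∧ v ≤ b s) → x s v = 0
  map : ∀ s v, a s ≤ v → f v (x s v) = x s (v + 1)
  card : ∀ v, cnt a b v v = finrank ℂ (W v)
  span : ∀ v, span ℂ (Set.range fun s => x s v) = W v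

theorem ChainBasis.span_subtype {E : Type*} [AddCommGroup E] [Module ℂ E] {f : ℕ → E →ₗ[ℂ] E}
    {W : ℕ → Submodule ℂ E} {ι : Type*} [Fintype ι] {a b : ι → ℕ} {x : ι → ℕ → E}
    (h : ChainBasis f W a b x) (v : ℕ) :
    Submodule.span ℂ (Set.range fun s : {s // a s ≤ v ∧ v ≤ b s} => x s v) = W v := by
  rw [← h.span v]
  apply le_antisymm
  · apply span_mono
    rintro _ ⟨s, rfl⟩
    exact ⟨s, rfl⟩
  · rw [span_le]
    rintro _ ⟨s, rfl⟩
    by_cases hs : a s ≤ v ∧ v ≤ b s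
    · exact subset_span ⟨⟨s, hs⟩, rfl⟩
    · simp [h.zero s v hs]

/-- A spanning family with as many members as the dimension is independent; hence the field `card`
stands in for independence. -/
theorem ChainBasis.indep {E : Type*} [AddCommGroup E] [Module ℂ E] {f : ℕ → E →ₗ[ℂ] E}
    {W : ℕ → Submodule ℂ E} {ι : Type*} [Fintype ι] {a b : ι → ℕ} {x : ι → ℕ → E}
    (h : ChainBasis f W a b x) (v : ℕ) :
    LinearIndependent ℂ (fun s : {s // a s ≤ v ∧ v ≤ b s} => x s v) := by
  rw [linearIndependent_iff_card_eq_finrank_span, Set.finrank, h.span_subtype, ← h.card,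
    Fintype.card_subtype, cnt]

theorem ChainBasis.comp_apply {E : Type*} [AddCommGroup E] [Module ℂ E] {f : ℕ → E →ₗ[ℂ] E}
    {W : ℕ → Submodule ℂ E} {ι : Type*} [Fintype ι] {a b : ι → ℕ} {x : ι → ℕ → E}
    (h : ChainBasis f W a b x) (s : ι) (p d : ℕ) (hp : a s ≤ p) :
    comp f p d (x s p) = x s (p + d) := by
  induction d with
  | zero => rfl
  | succ d ih =>
    change f (p + d) (comp f p d (x s p)) = _
    rw [ih, h.map s _ (by omega)]
    rfl

/-- The composite kills the chains that end before `p + d` and sends the others to part of the basis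
at `p + d`. This turns ranks into counts of intervals. -/
theorem ChainBasis.finrank_map_comp {E : Type*} [AddCommGroup E] [Module ℂ E]
    {f : ℕ → E →ₗ[ℂ] E}
    {W : ℕ → Submodule ℂ E} {ι : Type*} [Fintype ι] {a b : ι → ℕ} {x : ι → ℕ → E}
    (h : ChainBasis f W a b x) (p d : ℕ) :
    finrank ℂ ((W p).map (comp f p d)) = cnt a b p (p + d) := by
  have hind : LinearIndependent ℂ
      (fun s : {s // a s ≤ p ∧ p + d ≤ b s} => x s (p + d)) := by
    have := (h.indep (p + d)).comp
      (fun s : {s // a s ≤ p ∧ p + d ≤ b s} =>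
        (⟨s.1, by have := s.2; omega⟩ : {s // a s ≤ p + d ∧ p + d ≤ b s}))
      (by
        intro s t hst
        simpa [Subtype.ext_iff] using hst)
    exact this
  have hspan : (W p).map (comp f p d) =
      Submodule.span ℂ (Set.range fun s : {s // a s ≤ p ∧ p + d ≤ b s} => x s (p + d)) := by
    rw [← h.span p, map_span]
    apply le_antisymm
    · rw [span_le]
      rintro _ ⟨_, ⟨s, rfl⟩, rfl⟩
      by_cases hs : a s ≤ p
      · simp only [h.comp_apply s p d hs, SetLike.mem_coe]
        by_cases hb : p + d ≤ b s
        · exact subset_span ⟨⟨s, hs, hb⟩, rfl⟩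
        · rw [h.zero s _ (by omega)]
          exact zero_mem _
      · simp [h.zero s p (by omega)]
    · apply span_mono
      rintro _ ⟨s, rfl⟩
      exact ⟨x s p, ⟨s, rfl⟩, h.comp_apply s p d s.2.1⟩
  rw [hspan, finrank_span_eq_card hind, Fintype.card_subtype, cnt]

/-- Splitting off an interval of maximal length from a representation. -/
theorem exists_chain_complement {E : Type*} [AddCommGroup E] [Module ℂ E] [FiniteDimensional ℂ E]
    (f : ℕ → E →ₗ[ℂ] E) (W : ℕ → Submodule ℂ E) (hW : ∀ v, (W v).map (f v) ≤ W (v + 1))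
    (i d : ℕ) (x : E) (hx : x ∈ W i) (hne : comp f i d x ≠ 0)
    (hmax : ∀ v, ∀ y ∈ W v, comp f v (d + 1) y = 0) :
    ∃ C : ℕ → Submodule ℂ E, (∀ v, (C v).map (f v) ≤ C (v + 1)) ∧
      (∀ v, ¬ (i ≤ v ∧ v ≤ i + d) → C v = W v) ∧
      (∀ v, i ≤ v → v ≤ i + d → finrank ℂ (W v) = finrank ℂ (C v) + 1 ∧
        W v = C v ⊔ Submodule.span ℂ {comp f i (v - i) x}) := by
  -- A functional equal to 1 at the end of the chain of `x`. Pulled back to a vertex of the chain it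
  -- is 1 on the chain vector there, so its kernel in `W v` is a complement.
  obtain ⟨φ, hφ⟩ : ∃ φ : Module.Dual ℂ E, φ (comp f i d x) = 1 := by
    obtain ⟨φ, hφ⟩ : ∃ φ : Module.Dual ℂ E, φ (comp f i d x) ≠ 0 := by
      by_contra hcon
      push Not at hcon
      exact hne ((Module.forall_dual_apply_eq_zero_iff ℂ _).1 hcon)
    exact ⟨(φ (comp f i d x))⁻¹ • φ, by simp [hφ]⟩
  have hmem : ∀ m, comp f i m x ∈ W (i + m) := by
    intro m
    induction m with
    | zero => exact hx
    | succ m ih => exact hW _ (mem_map_of_mem ih)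
  refine ⟨fun v => if i ≤ v ∧ v ≤ i + d then
      W v ⊓ LinearMap.ker (φ ∘ₗ comp f v (i + d - v)) else W v, ?_, ?_, ?_⟩
  · intro v
    rintro _ ⟨y, hy, rfl⟩
    have hyW : y ∈ W v := by
      by_cases h : i ≤ v ∧ v ≤ i + d
      · simp only [h, and_self, if_true] at hy
        exact hy.1
      · simp only [h, if_false] at hy
        exact hy
    have hfy : f v y ∈ W (v + 1) := hW v (mem_map_of_mem hyW)
    by_cases h1 : i ≤ v + 1 ∧ v + 1 ≤ i + d
    · simp only [h1, and_self, if_true]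
      refine ⟨hfy, ?_⟩
      change φ (comp f (v + 1) (i + d - (v + 1)) (f v y)) = 0
      rw [← LinearMap.comp_apply (comp f (v + 1) _), ← comp_succ_left]
      -- At `v + 1 = i` the vector `y` is arbitrary in `W v`, but the composite from `v` has length
      -- `d + 1` and vanishes by maximality.
      by_cases h : i ≤ v
      · have h' : i ≤ v ∧ v ≤ i + d := by omega
        simp only [h', and_self, if_true] at hy
        have : φ (comp f v (i + d - v) y) = 0 := hy.2
        rwa [show i + d - v = i + d - (v + 1) + 1 by omega] at this
      · rw [show i + d - (v + 1) + 1 = d + 1 by omega, hmax v y hyW, map_zero]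
    · simp only [h1, if_false]
      exact hfy
  · intro v hv
    simp only [hv, if_false]
  · intro v h1 h2
    have hv : i ≤ v ∧ v ≤ i + d := ⟨h1, h2⟩
    beta_reduce
    rw [if_pos hv]
    set z := comp f i (v - i) x with hz
    set ψ := φ ∘ₗ comp f v (i + d - v) with hψ
    have hzW : z ∈ W v := by
      have := hmem (v - i)
      rwa [show i + (v - i) = v by omega] at this
    have hψz : ψ z = 1 := by
      change φ (comp f v (i + d - v) (comp f i (v - i) x)) = 1
      have := comp_add f i (v - i) (i + d - v)
      rw [show i + (v - i) = v by omega, show v - i + (i + d - v) = d by omega] at this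
      rw [← LinearMap.comp_apply (comp f v _), ← this, hφ]
    have hz0 : z ≠ 0 := by
      intro h0
      rw [h0, map_zero] at hψz
      exact zero_ne_one hψz
    have hsup : W v = W v ⊓ LinearMap.ker ψ ⊔ Submodule.span ℂ {z} := by
      apply le_antisymm
      · intro w hw
        rw [show w = (w - ψ w • z) + ψ w • z by abel]
        refine add_mem (mem_sup_left ⟨sub_mem hw (smul_mem _ _ hzW), ?_⟩)
          (mem_sup_right (smul_mem _ _ (mem_span_singleton_self z)))
        simp [hψz]
      · refine sup_le inf_le_left ?_
        rw [span_singleton_le_iff_mem]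
        exact hzW
    have hinf : (W v ⊓ LinearMap.ker ψ) ⊓ Submodule.span ℂ {z} = ⊥ := by
      rw [eq_bot_iff]
      rintro y ⟨⟨-, hy1⟩, hy2⟩
      obtain ⟨c, rfl⟩ := mem_span_singleton.1 hy2
      have : c = 0 := by simpa [hψz] using hy1
      simp [this]
    refine ⟨?_, hsup⟩
    have := finrank_sup_add_finrank_inf_eq (W v ⊓ LinearMap.ker ψ) (Submodule.span ℂ {z})
    rw [← hsup, hinf, finrank_bot, finrank_span_singleton hz0] at this
    simpa using this

theorem cnt_option {ι : Type*} [Fintype ι] (a b : ι → ℕ) (i j p q : ℕ) :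
    cnt (fun s : Option ι => s.elim i a) (fun s : Option ι => s.elim j b) p q =
      cnt a b p q + if i ≤ p ∧ q ≤ j then 1 else 0 := by
  simp only [cnt, Finset.card_filter, Fintype.sum_option, Option.elim_none, Option.elim_some]
  rw [add_comm]
  rfl

/-- Every representation of an equi-oriented quiver of type `A` is a direct sum of intervals. -/
theorem exists_chainBasis {E : Type*} [AddCommGroup E] [Module ℂ E] [FiniteDimensional ℂ E]
    (f : ℕ → E →ₗ[ℂ] E) (ℓ : ℕ) (W : ℕ → Submodule ℂ E)
    (hW : ∀ v, (W v).map (f v) ≤ W (v + 1)) (hℓ : ∀ v, ℓ < v → W v = ⊥) :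
    ∃ (ι : Type) (_ : Fintype ι) (a b : ι → ℕ) (x : ι → ℕ → E),
      (∀ s, a s ≤ b s ∧ b s ≤ ℓ) ∧ ChainBasis f W a b x := by
  induction hn : ∑ v ∈ Finset.range (ℓ + 1), finrank ℂ (W v) using Nat.strong_induction_on
    generalizing W with
  | _ n ih =>
    by_cases h0 : ∀ v, W v = ⊥
    · refine ⟨Empty, inferInstance, Empty.elim, Empty.elim, Empty.elim, fun s => s.elim,
        ⟨fun s => s.elim, fun s => s.elim, ?_, ?_⟩⟩
      · intro v
        rw [h0 v]
        simp [cnt]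
      · intro v
        rw [h0 v]
        simp
    push Not at h0
    have hmapW : ∀ v d, ∀ y ∈ W v, comp f v d y ∈ W (v + d) := by
      intro v d y hy
      induction d with
      | zero => exact hy
      | succ d ihd => exact hW _ (mem_map_of_mem ihd)
    -- The chain to split off is a longest nonzero one; lengths are bounded because `W` vanishes
    -- beyond `ℓ`.
    let P : ℕ → Prop := fun d => ∃ v, ∃ y ∈ W v, comp f v d y ≠ 0
    have hP0 : P 0 := by
      obtain ⟨v, hv⟩ := h0
      obtain ⟨y, hy, hy0⟩ := (Submodule.ne_bot_iff _).1 hv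
      exact ⟨v, y, hy, hy0⟩
    have hPle : ∀ v d, ∀ y ∈ W v, comp f v d y ≠ 0 → v + d ≤ ℓ := by
      intro v d y hy hne
      by_contra hlt
      have := hmapW v d y hy
      rw [hℓ _ (by omega), mem_bot] at this
      exact hne this
    classical
    obtain ⟨d, ⟨i, x, hx, hne⟩, hdmax⟩ : ∃ d, P d ∧ ∀ e, P e → e ≤ d := by
      refine ⟨Nat.findGreatest P ℓ, Nat.findGreatest_spec (Nat.zero_le _) hP0, fun e he => ?_⟩
      obtain ⟨v, y, hy, hne⟩ := he
      have := hPle v e y hy hne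
      exact Nat.le_findGreatest (by omega) ⟨v, y, hy, hne⟩
    have hid : i + d ≤ ℓ := hPle i d x hx hne
    have hmax : ∀ v, ∀ y ∈ W v, comp f v (d + 1) y = 0 := by
      intro v y hy
      by_contra hcon
      have := hdmax (d + 1) ⟨v, y, hy, hcon⟩
      omega
    obtain ⟨C, hC, hCout, hCin⟩ := exists_chain_complement f W hW i d x hx hne hmax
    have hlt : ∑ v ∈ Finset.range (ℓ + 1), finrank ℂ (C v) < n := by
      rw [← hn]
      apply Finset.sum_lt_sum
      · intro v _
        by_cases hv : i ≤ v ∧ v ≤ i + d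
        · have := (hCin v hv.1 hv.2).1
          omega
        · rw [hCout v hv]
      · refine ⟨i, Finset.mem_range.2 (by omega), ?_⟩
        have := (hCin i le_rfl (by omega)).1
        omega
    obtain ⟨ι, hι, a, b, y, hab, hy⟩ := ih _ hlt C hC (fun v hv => by
      rw [hCout v (by omega), hℓ v hv]) rfl
    refine ⟨Option ι, inferInstance, fun s => s.elim i a, fun s => s.elim (i + d) b,
      fun s v => s.elim (if i ≤ v ∧ v ≤ i + d then comp f i (v - i) x else 0) (fun s => y s v),
      ?_, ⟨?_, ?_, ?_, ?_⟩⟩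
    · rintro (_ | s)
      · exact ⟨Nat.le_add_right _ _, hid⟩
      · exact hab s
    · rintro (_ | s) v hv
      · simp only [Option.elim] at hv ⊢
        rw [if_neg hv]
      · exact hy.zero s v hv
    · rintro (_ | s) v hv
      · simp only [Option.elim] at hv ⊢
        by_cases h1 : v + 1 ≤ i + d
        · rw [if_pos (show i ≤ v ∧ v ≤ i + d by omega),
            if_pos (show i ≤ v + 1 ∧ v + 1 ≤ i + d by omega),
            show v + 1 - i = v - i + 1 by omega]
          change _ = f (i + (v - i)) (comp f i (v - i) x)
          rw [show i + (v - i) = v by omega]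
        · rw [if_neg (show ¬ (i ≤ v + 1 ∧ v + 1 ≤ i + d) by omega)]
          by_cases h2 : v ≤ i + d
          · rw [if_pos ⟨hv, h2⟩]
            have := hmax i x hx
            rw [show v = i + d by omega, Nat.add_sub_cancel_left]
            exact this
          · rw [if_neg (by omega), map_zero]
      · exact hy.map s v hv
    · intro v
      rw [cnt_option, hy.card v]
      by_cases hv : i ≤ v ∧ v ≤ i + d
      · rw [if_pos hv, (hCin v hv.1 hv.2).1]
      · rw [if_neg hv, hCout v hv, add_zero]
    · intro v
      have hr : (Set.range fun s : Option ι =>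
          s.elim (if i ≤ v ∧ v ≤ i + d then comp f i (v - i) x else 0) (fun s => y s v)) =
          Set.range (fun s => y s v) ∪
            {if i ≤ v ∧ v ≤ i + d then comp f i (v - i) x else 0} := by
        ext z
        simp only [Set.mem_range, Option.exists, Option.elim, Set.mem_union,
          Set.mem_singleton_iff]
        constructor
        · rintro (h | h)
          · exact Or.inr h.symm
          · exact Or.inl h
        · rintro (h | h)
          · exact Or.inr h
          · exact Or.inl h.symm
      rw [hr, span_union, hy.span v]
      by_cases hv : i ≤ v ∧ v ≤ i + d
      · rw [if_pos hv, (hCin v hv.1 hv.2).2]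
      · rw [if_neg hv, hCout v hv]
        simp

/-! ### Combinatorics of interval families and their counts -/

theorem cnt_eq_add_last {ι : Type*} [Fintype ι] (a b : ι → ℕ) (p q r : ℕ) (h : q ≤ r) :
    cnt a b p q =
      cnt a b p r + (Finset.univ.filter fun s => a s ≤ p ∧ q ≤ b s ∧ b s < r).card := by
  classical
  rw [cnt, cnt, ← Finset.card_union_of_disjoint]
  · congr 1
    ext s
    simp only [Finset.mem_filter, Finset.mem_univ, true_and, Finset.mem_union]
    omega
  · rw [Finset.disjoint_left]
    intro s
    simp only [Finset.mem_filter, Finset.mem_univ, true_and]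
    omega

theorem cnt_eq_add_first {ι : Type*} [Fintype ι] (a b : ι → ℕ) (p q : ℕ) :
    cnt a b p q = (Finset.univ.filter fun s => a s < p ∧ q ≤ b s).card +
      (Finset.univ.filter fun s => a s = p ∧ q ≤ b s).card := by
  classical
  rw [cnt, ← Finset.card_union_of_disjoint]
  · congr 1
    ext s
    simp only [Finset.mem_filter, Finset.mem_univ, true_and, Finset.mem_union]
    omega
  · rw [Finset.disjoint_left]
    intro s
    simp only [Finset.mem_filter, Finset.mem_univ, true_and]
    omega

theorem card_eq_add_fiber {ι : Type*} [Fintype ι] (a b : ι → ℕ) (i j : ℕ) :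
    (Finset.univ.filter fun s => a s = i ∧ j ≤ b s).card =
      (Finset.univ.filter fun s => a s = i ∧ j + 1 ≤ b s).card +
        (Finset.univ.filter fun s => (a s, b s) = (i, j)).card := by
  classical
  rw [← Finset.card_union_of_disjoint]
  · congr 1
    ext s
    simp only [Finset.mem_filter, Finset.mem_univ, true_and, Finset.mem_union, Prod.mk.injEq]
    omega
  · rw [Finset.disjoint_left]
    intro s
    simp only [Finset.mem_filter, Finset.mem_univ, true_and, Prod.mk.injEq]
    omega

theorem card_lt_eq {ι κ : Type*} [Fintype ι] [Fintype κ] (a b : ι → ℕ) (a' b' : κ → ℕ) (p q : ℕ)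
    (h : ∀ p' < p, cnt a' b' p' q = cnt a b p' q) :
    (Finset.univ.filter fun s => a' s < p ∧ q ≤ b' s).card =
      (Finset.univ.filter fun s => a s < p ∧ q ≤ b s).card := by
  rcases p with _ | p
  · simp
  · simpa only [cnt, Nat.lt_succ_iff] using h p (Nat.lt_succ_self p)

/-- If the counts of the family `(a', b')` are bounded by those of `(a, b)` and are not all the
same, then two intervals of `(a', b')` can be made to exchange their right ends without violating
the bounds. -/
theorem exists_exchange {ι κ : Type*} [Fintype ι] [Fintype κ] (a b : ι → ℕ) (a' b' : κ → ℕ)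
    (ℓ : ℕ) (hab' : ∀ s, a' s ≤ b' s) (hb : ∀ s, b s ≤ ℓ)
    (hle : ∀ p q, p ≤ q → cnt a' b' p q ≤ cnt a b p q)
    (hdiag : ∀ p, cnt a' b' p p = cnt a b p p)
    (hne : ∃ p q, p ≤ q ∧ cnt a' b' p q < cnt a b p q) :
    ∃ s t, a' s < a' t ∧ a' t ≤ b' s + 1 ∧ b' s < b' t ∧
      ∀ p q, p ≤ q → a' s ≤ p → p < a' t → b' s < q → q ≤ b' t →
        cnt a' b' p q < cnt a b p q := by
  classical
  -- Take the smallest `p` with a strict inequality and, for it, the largest such `q`.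
  obtain ⟨p, ⟨q₀, hpq₀, hq₀⟩, hpmin⟩ : ∃ p, (∃ q, p ≤ q ∧ cnt a' b' p q < cnt a b p q) ∧
      ∀ p' < p, ∀ q, p' ≤ q → cnt a' b' p' q = cnt a b p' q := by
    refine ⟨Nat.find hne, Nat.find_spec hne, fun p' hp' q hq => ?_⟩
    have := Nat.find_min hne hp'
    push Not at this
    exact le_antisymm (hle _ _ hq) (this q hq)
  obtain ⟨q, hpq, hq, hqmax⟩ : ∃ q, p ≤ q ∧ cnt a' b' p q < cnt a b p q ∧
      ∀ y, q < y → cnt a' b' p y = cnt a b p y := by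
    let P : ℕ → Prop := fun q => p ≤ q ∧ cnt a' b' p q < cnt a b p q
    have hPle : ∀ y, P y → y ≤ ℓ := by
      rintro y ⟨-, hy⟩
      by_contra hlt
      have : cnt a b p y = 0 := by
        rw [cnt, Finset.card_eq_zero, Finset.filter_eq_empty_iff]
        intro s _ hs
        have := hb s
        omega
      omega
    have hspec : P (Nat.findGreatest P ℓ) :=
      Nat.findGreatest_spec (hPle q₀ ⟨hpq₀, hq₀⟩) ⟨hpq₀, hq₀⟩
    refine ⟨Nat.findGreatest P ℓ, hspec.1, hspec.2, fun y hy => ?_⟩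
    have hpy : p ≤ y := hspec.1.trans hy.le
    by_contra hcon
    have hPy : P y := ⟨hpy, lt_of_le_of_ne (hle _ _ hpy) hcon⟩
    have := Nat.le_findGreatest (hPle y hPy) hPy
    omega
  -- The counts for smaller left bounds agree, so only intervals starting exactly at `p` make the
  -- difference.
  have hrow : ∀ y, p ≤ y →
      ((Finset.univ.filter fun s => a' s = p ∧ y ≤ b' s).card <
        (Finset.univ.filter fun s => a s = p ∧ y ≤ b s).card ↔
      cnt a' b' p y < cnt a b p y) := by
    intro y hy
    rw [cnt_eq_add_first a' b', cnt_eq_add_first a b,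
      card_lt_eq a b a' b' p y (fun p' hp' => hpmin p' hp' y (by omega))]
    omega
  have hgap : ∀ y, p ≤ y → y ≤ q → (∀ s, a' s = p → y ≤ b' s → q ≤ b' s) →
      cnt a' b' p y < cnt a b p y := by
    intro y hy hyq hno
    rw [← hrow y hy]
    calc (Finset.univ.filter fun s => a' s = p ∧ y ≤ b' s).card
        ≤ (Finset.univ.filter fun s => a' s = p ∧ q ≤ b' s).card := by
          apply Finset.card_le_card
          intro s
          simp only [Finset.mem_filter, Finset.mem_univ, true_and]
          exact fun h => ⟨h.1, hno s h.1 h.2⟩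
      _ < (Finset.univ.filter fun s => a s = p ∧ q ≤ b s).card := (hrow q hpq).2 hq
      _ ≤ (Finset.univ.filter fun s => a s = p ∧ y ≤ b s).card := by
          apply Finset.card_le_card
          intro s
          simp only [Finset.mem_filter, Finset.mem_univ, true_and]
          omega
  -- Among the intervals from `p` ending before `q`, take one with the largest end. One exists,
  -- since otherwise `hgap` would give strictness at `(p, p)`, against `hdiag`.
  obtain ⟨s, ⟨hsa, hsb⟩, hsmax⟩ : ∃ s, (a' s = p ∧ b' s < q) ∧
      ∀ t, a' t = p → b' t < q → b' t ≤ b' s := by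
    have hS : (Finset.univ.filter fun s => a' s = p ∧ b' s < q).Nonempty := by
      by_contra hcon
      rw [Finset.not_nonempty_iff_eq_empty, Finset.filter_eq_empty_iff] at hcon
      have := hgap p le_rfl hpq (fun s hs _ => by
        have := hcon (Finset.mem_univ s)
        omega)
      have := hdiag p
      omega
    obtain ⟨s, hs, hmax⟩ := Finset.exists_max_image _ b' hS
    simp only [Finset.mem_filter, Finset.mem_univ, true_and] at hs hmax
    exact ⟨s, hs, fun t h1 h2 => hmax t ⟨h1, h2⟩⟩
  have hps : p ≤ b' s := hsa ▸ hab' s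
  have hcol : ∀ y, b' s < y → y ≤ q → cnt a' b' p y < cnt a b p y := by
    intro y h1 h2
    refine hgap y (by omega) h2 (fun t ht hyt => ?_)
    by_contra hlt
    have := hsmax t ht (by omega)
    omega
  -- Strictness passes from `p` to `p'`: at column `q + 1` there is equality for `p` and `≤` for
  -- `p'`, while among the intervals ending in `[y, q]` the primed family gains none between `p` and
  -- `p'`.
  have hrect : ∀ p' y, p ≤ p' → p' ≤ y → b' s < y → y ≤ q →
      (∀ t, p < a' t → b' s < b' t → b' t ≤ q → p' < a' t) →
      cnt a' b' p' y < cnt a b p' y := by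
    intro p' y hp' hp'y hy hyq hno
    have e1 := cnt_eq_add_last a' b' p' y (q + 1) (by omega)
    have e2 := cnt_eq_add_last a b p' y (q + 1) (by omega)
    have e3 := cnt_eq_add_last a' b' p y (q + 1) (by omega)
    have e4 := cnt_eq_add_last a b p y (q + 1) (by omega)
    have e5 := hle p' (q + 1) (by omega)
    have e6 := hqmax (q + 1) (by omega)
    have e7 := hcol y hy hyq
    have e8 : (Finset.univ.filter fun s => a' s ≤ p' ∧ y ≤ b' s ∧ b' s < q + 1).card ≤
        (Finset.univ.filter fun s => a' s ≤ p ∧ y ≤ b' s ∧ b' s < q + 1).card := by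
      apply Finset.card_le_card
      intro t
      simp only [Finset.mem_filter, Finset.mem_univ, true_and]
      intro ht
      refine ⟨?_, ht.2⟩
      by_contra hlt
      have := hno t (by omega) (by omega) (by omega)
      omega
    have e9 : (Finset.univ.filter fun s => a s ≤ p ∧ y ≤ b s ∧ b s < q + 1).card ≤
        (Finset.univ.filter fun s => a s ≤ p' ∧ y ≤ b s ∧ b s < q + 1).card := by
      apply Finset.card_le_card
      intro t
      simp only [Finset.mem_filter, Finset.mem_univ, true_and]
      omega
    omega
  -- The smallest left end makes the rectangle in the conclusion free of the intervals excluded in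
  -- `hrect`. It is at most `b' s + 1`, since otherwise `hrect` would reach the diagonal point `(b'
  -- s + 1, b' s + 1)`.
  obtain ⟨t, ⟨hta, htb, htq⟩, htmin, htle⟩ : ∃ t, (p < a' t ∧ b' s < b' t ∧ b' t ≤ q) ∧
      (∀ u, p < a' u → b' s < b' u → b' u ≤ q → a' t ≤ a' u) ∧ a' t ≤ b' s + 1 := by
    have hT : ∃ t, (p < a' t ∧ b' s < b' t ∧ b' t ≤ q) ∧ a' t ≤ b' s + 1 := by
      by_contra hcon
      push Not at hcon
      have := hrect (b' s + 1) (b' s + 1) (by omega) le_rfl (by omega) (by omega)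
        (fun t h1 h2 h3 => hcon t ⟨h1, h2, h3⟩)
      have := hdiag (b' s + 1)
      omega
    obtain ⟨t₀, ht₀, ht₀'⟩ := hT
    have hS : (Finset.univ.filter fun t => p < a' t ∧ b' s < b' t ∧ b' t ≤ q).Nonempty :=
      ⟨t₀, by simpa using ht₀⟩
    obtain ⟨t, ht, hmin⟩ := Finset.exists_min_image _ a' hS
    simp only [Finset.mem_filter, Finset.mem_univ, true_and] at ht hmin
    exact ⟨t, ht, fun u h1 h2 h3 => hmin u ⟨h1, h2, h3⟩, (hmin t₀ ht₀).trans ht₀'⟩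
  refine ⟨s, t, by omega, htle, htb, fun p' y hp'y h1 h2 h3 h4 => ?_⟩
  refine hrect p' y (by omega) hp'y h3 (by omega) (fun u hu1 hu2 hu3 => ?_)
  exact lt_of_lt_of_le h2 (htmin u hu1 hu2 hu3)

/-- The counts after two intervals have exchanged their right ends. -/
theorem cnt_exchange {κ : Type*} [Fintype κ] [DecidableEq κ] (a b : κ → ℕ) {s t : κ}
    (ha : a s < a t) (hb : b s < b t) (p q : ℕ) :
    cnt a (b ∘ Equiv.swap s t) p q =
      cnt a b p q + if a s ≤ p ∧ p < a t ∧ b s < q ∧ q ≤ b t then 1 else 0 := by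
  have hst : s ≠ t := by
    rintro rfl
    omega
  simp only [cnt, Finset.card_filter]
  have hmem : t ∈ Finset.univ.erase s := by simp [hst.symm]
  rw [← Finset.add_sum_erase _ _ (Finset.mem_univ s), ← Finset.add_sum_erase _ _ hmem,
    ← Finset.add_sum_erase (a := s) Finset.univ (fun i => if a i ≤ p ∧ q ≤ b i then 1 else 0)
      (Finset.mem_univ s), ← Finset.add_sum_erase _ (fun i => if a i ≤ p ∧ q ≤ b i then 1 else 0) hmem]
  have hrest : ∑ i ∈ (Finset.univ.erase s).erase t,
      (if a i ≤ p ∧ q ≤ (b ∘ Equiv.swap s t) i then 1 else 0) =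
      ∑ i ∈ (Finset.univ.erase s).erase t, (if a i ≤ p ∧ q ≤ b i then 1 else 0) := by
    refine Finset.sum_congr rfl fun i hi => ?_
    simp only [Finset.mem_erase] at hi
    rw [Function.comp_apply, Equiv.swap_apply_of_ne_of_ne hi.2.1 hi.1]
  rw [hrest]
  simp only [Function.comp_apply, Equiv.swap_apply_left, Equiv.swap_apply_right]
  split_ifs <;> omega

/-- A family of non-empty intervals is determined by its counts, up to reindexing. -/
theorem exists_equiv_of_cnt_eq {ι κ : Type*} [Fintype ι] [Fintype κ] (a b : ι → ℕ)
    (a' b' : κ → ℕ) (hab : ∀ s, a s ≤ b s) (hab' : ∀ s, a' s ≤ b' s)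
    (h : ∀ p q, p ≤ q → cnt a' b' p q = cnt a b p q) :
    ∃ σ : κ ≃ ι, ∀ s, a (σ s) = a' s ∧ b (σ s) = b' s := by
  classical
  -- The multiplicity of `[i, j]` is a second difference of the counts: isolate the left end `i`,
  -- then the right end `j`.
  have key : ∀ i j, Fintype.card {s // (a' s, b' s) = (i, j)} =
      Fintype.card {s // (a s, b s) = (i, j)} := by
    intro i j
    by_cases hij : i ≤ j
    · have hrow : ∀ y, i ≤ y → (Finset.univ.filter fun s => a' s = i ∧ y ≤ b' s).card =
          (Finset.univ.filter fun s => a s = i ∧ y ≤ b s).card := by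
        intro y hy
        have e1 := cnt_eq_add_first a' b' i y
        have e2 := cnt_eq_add_first a b i y
        have e3 := card_lt_eq a b a' b' i y (fun p' hp' => h p' y (by omega))
        have e4 := h i y hy
        omega
      have e1 := card_eq_add_fiber a' b' i j
      have e2 := card_eq_add_fiber a b i j
      have e3 := hrow j hij
      have e4 := hrow (j + 1) (by omega)
      rw [Fintype.card_subtype, Fintype.card_subtype]
      omega
    · have h1 : IsEmpty {s // (a' s, b' s) = (i, j)} := ⟨fun s => by
        have := hab' s.1
        have := s.2
        simp only [Prod.mk.injEq] at this
        omega⟩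
      have h2 : IsEmpty {s // (a s, b s) = (i, j)} := ⟨fun s => by
        have := hab s.1
        have := s.2
        simp only [Prod.mk.injEq] at this
        omega⟩
      rw [Fintype.card_eq_zero, Fintype.card_eq_zero]
  let σ : κ ≃ ι := Equiv.ofFiberEquiv (f := fun s => (a' s, b' s)) (g := fun s => (a s, b s))
    (fun c => Fintype.equivOfCardEq (key c.1 c.2))
  refine ⟨σ, fun s => ?_⟩
  have := Equiv.ofFiberEquiv_map (f := fun s => (a' s, b' s)) (g := fun s => (a s, b s))
    (fun c => Fintype.equivOfCardEq (key c.1 c.2)) s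
  exact ⟨congrArg Prod.fst this, congrArg Prod.snd this⟩

/-! ### Exchanging right ends of two chains -/

/-- Linear maps can be prescribed on one layer of a chain basis. -/
theorem ChainBasis.exists_linearMap {E : Type*} [AddCommGroup E] [Module ℂ E] {f : ℕ → E →ₗ[ℂ] E}
    {W : ℕ → Submodule ℂ E} {ι : Type*} [Fintype ι] {a b : ι → ℕ} {x : ι → ℕ → E}
    (h : ChainBasis f W a b x) (v : ℕ) (z : ι → E) :
    ∃ g : E →ₗ[ℂ] E, ∀ s, a s ≤ v → v ≤ b s → g (x s v) = z s := by
  have hind := h.indep v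
  obtain ⟨g, hg⟩ := LinearMap.exists_extend
    ((Basis.span hind).constr ℂ (fun s : {s // a s ≤ v ∧ v ≤ b s} => z s))
  refine ⟨g, fun s h1 h2 => ?_⟩
  have h3 := (Basis.span hind).constr_basis ℂ (fun s : {s // a s ≤ v ∧ v ≤ b s} => z s) ⟨s, h1, h2⟩
  rw [← hg, LinearMap.comp_apply] at h3
  rw [← h3]
  congr 1
  exact congrArg Subtype.val (Basis.span_apply hind ⟨s, h1, h2⟩).symm

/-- Adding a map from the end of the chain `s` to the interior of the chain `t` makes the two
chains exchange their right ends. -/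
theorem ChainBasis.exchange {E : Type*} [AddCommGroup E] [Module ℂ E] {f : ℕ → E →ₗ[ℂ] E}
    {W : ℕ → Submodule ℂ E} {ι : Type*} [Fintype ι] [DecidableEq ι] {a b : ι → ℕ}
    {x : ι → ℕ → E} (h : ChainBasis f W a b x) {s t : ι} (ha : a s < a t) (hab : a t ≤ b s + 1)
    (hb : b s < b t) (g : E →ₗ[ℂ] E) (hgs : g (x s (b s)) = x t (b s + 1))
    (hg : ∀ u, u ≠ s → g (x u (b s)) = 0) (c : ℂ) (hc : c ≠ 0) :
    ∃ y, ChainBasis (fun v => f v + if v = b s then c • g else 0) W a (b ∘ Equiv.swap s t) y := by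
  have hst : s ≠ t := by
    rintro rfl
    omega
  -- The new chain `s` continues along `c • x t` after `b s`. The new chain `t` is corrected by `c⁻¹
  -- • x s`, so that the perturbed map kills it at `b s`; it is empty when `a t = b s + 1`.
  let y : ι → ℕ → E := fun u v =>
    if u = s then (if v ≤ b s then x s v else c • x t v)
    else if u = t then (if v ≤ b s ∧ a t ≤ v then x t v - c⁻¹ • x s v else 0)
    else x u v
  have ys : ∀ v, y s v = if v ≤ b s then x s v else c • x t v := fun v => if_pos rfl
  have yt : ∀ v, y t v = if v ≤ b s ∧ a t ≤ v then x t v - c⁻¹ • x s v else 0 := fun v => by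
    simp only [y, if_neg hst.symm, if_true]
  have yu : ∀ u v, u ≠ s → u ≠ t → y u v = x u v := fun u v h1 h2 => by
    simp only [y, if_neg h1, if_neg h2]
  have bs : (b ∘ Equiv.swap s t) s = b t := by simp
  have bt : (b ∘ Equiv.swap s t) t = b s := by simp
  have bu : ∀ u, u ≠ s → u ≠ t → (b ∘ Equiv.swap s t) u = b u := fun u h1 h2 => by
    simp [Equiv.swap_apply_of_ne_of_ne h1 h2]
  refine ⟨y, ⟨?_, ?_, ?_, ?_⟩⟩
  · intro u v hv
    by_cases hus : u = s
    · subst hus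
      rw [bs] at hv
      rw [ys]
      split_ifs with h1
      · exact h.zero _ _ (by omega)
      · rw [h.zero t v (by omega), smul_zero]
    by_cases hut : u = t
    · subst hut
      rw [bt] at hv
      rw [yt, if_neg (by omega)]
    · rw [bu u hus hut] at hv
      rw [yu u v hus hut, h.zero u v hv]
  · intro u v hv
    rw [LinearMap.add_apply]
    by_cases hus : u = s
    · subst hus
      rw [ys, ys]
      rcases lt_trichotomy v (b u) with hlt | rfl | hgt
      · rw [if_neg hlt.ne, if_pos hlt.le, if_pos (Nat.succ_le_of_lt hlt), h.map _ _ hv]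
        simp
      · rw [if_pos rfl, if_pos le_rfl, if_neg (by omega), h.map _ _ hv, h.zero u _ (by omega),
          LinearMap.smul_apply, hgs, zero_add]
      · rw [if_neg hgt.ne', if_neg (by omega), if_neg (by omega), map_smul,
          h.map t v (by omega)]
        simp
    by_cases hut : u = t
    · subst hut
      rw [yt, yt]
      rcases lt_trichotomy v (b s) with hlt | rfl | hgt
      · rw [if_neg hlt.ne, if_pos ⟨hlt.le, hv⟩, if_pos ⟨hlt, by omega⟩, map_sub, map_smul,
          h.map _ _ hv, h.map s v (by omega)]
        simp
      · rw [if_pos rfl, if_pos ⟨le_rfl, hv⟩, if_neg (by omega), map_sub, map_smul,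
          h.map _ _ hv, h.map s _ (by omega), h.zero s _ (by omega), LinearMap.smul_apply,
          map_sub, map_smul, hgs, hg u hus, zero_sub, smul_neg, smul_smul, mul_inv_cancel₀ hc]
        simp
      · rw [if_neg hgt.ne', if_neg (by omega), if_neg (by omega)]
        simp
    · rw [yu _ _ hus hut, yu _ _ hus hut, h.map _ _ hv]
      split_ifs with h1
      · rw [h1, LinearMap.smul_apply, hg u hus]
        simp
      · simp
  · intro v
    rw [cnt_exchange a b ha hb, if_neg (by omega), add_zero, h.card v]
  · intro v
    rw [← h.span v]
    have hx : ∀ u, x u v ∈ Submodule.span ℂ (Set.range fun u => x u v) :=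
      fun u => subset_span ⟨u, rfl⟩
    have hy : ∀ u, y u v ∈ Submodule.span ℂ (Set.range fun u => y u v) :=
      fun u => subset_span ⟨u, rfl⟩
    apply le_antisymm
    · rw [span_le]
      rintro _ ⟨u, rfl⟩
      simp only [y]
      split_ifs
      · exact hx s
      · exact smul_mem _ _ (hx t)
      · exact sub_mem (hx t) (smul_mem _ _ (hx s))
      · exact zero_mem _
      · exact hx u
    · rw [span_le]
      rintro _ ⟨u, rfl⟩
      change x u v ∈ _
      by_cases hus : u = s
      · subst hus
        by_cases h1 : v ≤ b u
        · have := hy u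
          rwa [ys, if_pos h1] at this
        · rw [h.zero u v (by omega)]
          exact zero_mem _
      by_cases hut : u = t
      · subst hut
        by_cases h1 : v ≤ b s
        · by_cases h2 : a u ≤ v
          · have := add_mem (hy u) (smul_mem _ c⁻¹ (hy s))
            rwa [ys, yt, if_pos h1, if_pos ⟨h1, h2⟩, sub_add_cancel] at this
          · rw [h.zero u v (by omega)]
            exact zero_mem _
        · have := smul_mem _ c⁻¹ (hy s)
          rwa [ys, if_neg h1, smul_smul, inv_mul_cancel₀ hc, one_smul] at this
      · have := hy u
        rwa [yu u v hus hut] at this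

theorem ChainBasis.reindex {E : Type*} [AddCommGroup E] [Module ℂ E] {f : ℕ → E →ₗ[ℂ] E}
    {W : ℕ → Submodule ℂ E} {ι κ : Type*} [Fintype ι] [Fintype κ] {a b : ι → ℕ} {x : ι → ℕ → E}
    (h : ChainBasis f W a b x) (σ : κ ≃ ι) :
    ChainBasis f W (a ∘ σ) (b ∘ σ) (x ∘ σ) where
  zero s := h.zero (σ s)
  map s := h.map (σ s)
  card v := by
    rw [← h.card v, cnt, cnt, Finset.card_filter, Finset.card_filter]
    exact σ.sum_comp (fun s => if a s ≤ v ∧ v ≤ b s then 1 else 0)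
  span v := by
    rw [← h.span v]
    congr 1
    exact σ.surjective.range_comp (fun s => x s v)

/-! ### Ranks and orbits of points of the representation space -/

/-- The maps of a point of the representation space, continued by zero. -/
def ext {ℓ N : ℕ} (M : RepSpace ℓ N) (k : ℕ) : (Fin N → ℂ) →ₗ[ℂ] (Fin N → ℂ) :=
  if h : k < ℓ then (M ⟨k, h⟩).mulVecLin else 0

/-- The spaces of a point of the representation space, continued by zero. -/
def full (ℓ N : ℕ) (v : ℕ) : Submodule ℂ (Fin N → ℂ) := if v ≤ ℓ then ⊤ else ⊥

/-- The rank of the composite map from the vertex `p` to the vertex `p + d`. -/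
def rk {ℓ N : ℕ} (M : RepSpace ℓ N) (p d : ℕ) : ℕ :=
  finrank ℂ (LinearMap.range (comp (ext M) p d))

theorem rk_le {ℓ N : ℕ} (M : RepSpace ℓ N) (p d : ℕ) : rk M p d ≤ N := by
  simpa [rk] using Submodule.finrank_le (LinearMap.range (comp (ext M) p d))

theorem map_ext_full {ℓ N : ℕ} (M : RepSpace ℓ N) (v : ℕ) :
    (full ℓ N v).map (ext M v) ≤ full ℓ N (v + 1) := by
  by_cases h : v < ℓ
  · rw [full, full, if_pos (show v + 1 ≤ ℓ by omega)]
    exact le_top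
  · rw [ext, dif_neg h, Submodule.map_zero]
    exact bot_le

theorem exists_chainBasis_ext {ℓ N : ℕ} (M : RepSpace ℓ N) :
    ∃ (ι : Type) (_ : Fintype ι) (a b : ι → ℕ) (x : ι → ℕ → Fin N → ℂ),
      (∀ s, a s ≤ b s ∧ b s ≤ ℓ) ∧ ChainBasis (ext M) (full ℓ N) a b x :=
  exists_chainBasis (ext M) ℓ (full ℓ N) (map_ext_full M) fun v hv => if_neg (by omega)

theorem ChainBasis.rk_eq {ℓ N : ℕ} {M : RepSpace ℓ N} {ι : Type*} [Fintype ι] {a b : ι → ℕ}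
    {x : ι → ℕ → Fin N → ℂ} (h : ChainBasis (ext M) (full ℓ N) a b x) (p d : ℕ) (hp : p + d ≤ ℓ) :
    rk M p d = cnt a b p (p + d) := by
  rw [← h.finrank_map_comp, full, if_pos (by omega), Submodule.map_top, rk]

/-- Points with chain bases of the same type lie in the same orbit. -/
theorem ChainBasis.mem_orbit {ℓ N : ℕ} {K L : RepSpace ℓ N} {ι : Type*} [Fintype ι] {a b : ι → ℕ}
    {x y : ι → ℕ → Fin N → ℂ} (hK : ChainBasis (ext K) (full ℓ N) a b x)
    (hL : ChainBasis (ext L) (full ℓ N) a b y) : K ∈ orbit L := by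
  have htop : ∀ v, v ≤ ℓ → full ℓ N v = ⊤ := fun v hv => if_pos hv
  let B (v : Fin (ℓ + 1)) : Basis {s // a s ≤ v ∧ v ≤ b s} ℂ (Fin N → ℂ) :=
    Basis.mk (hK.indep v) (by rw [hK.span_subtype, htop v (by omega)])
  let C (v : Fin (ℓ + 1)) : Basis {s // a s ≤ v ∧ v ≤ b s} ℂ (Fin N → ℂ) :=
    Basis.mk (hL.indep v) (by rw [hL.span_subtype, htop v (by omega)])
  let φ (v : Fin (ℓ + 1)) : (Fin N → ℂ) ≃ₗ[ℂ] (Fin N → ℂ) := (C v).equiv (B v) (Equiv.refl _)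
  have hφ : ∀ v s, φ v (y s v) = x s v := by
    intro v s
    by_cases hs : a s ≤ v ∧ v ≤ b s
    · have := (C v).equiv_apply ⟨s, hs⟩ (B v) (Equiv.refl _)
      simpa only [B, C, Basis.mk_apply, Equiv.refl_apply] using this
    · rw [hK.zero s v hs, hL.zero s v hs, map_zero]
  let g (v : Fin (ℓ + 1)) : GL (Fin N) ℂ :=
    ⟨LinearMap.toMatrix' (φ v).toLinearMap, LinearMap.toMatrix' (φ v).symm.toLinearMap,
      by rw [← LinearMap.toMatrix'_comp]; simp, by rw [← LinearMap.toMatrix'_comp]; simp⟩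
  refine ⟨g, ?_⟩
  funext k
  -- It suffices to compare on the basis: in both representations the arrow moves the vector of `s`
  -- one step along its chain.
  have hcomm : (φ k.succ).toLinearMap ∘ₗ (L k).mulVecLin =
      (K k).mulVecLin ∘ₗ (φ k.castSucc).toLinearMap := by
    refine (C k.castSucc).ext fun s => ?_
    have e1 := hK.map s k s.2.1
    have e2 := hL.map s k s.2.1
    simp only [ext, dif_pos k.2] at e1 e2
    have e3 := hφ k.castSucc s
    have e4 := hφ k.succ s
    simp only [Fin.val_castSucc, Fin.val_succ] at e3 e4
    simp only [C, Basis.mk_apply, LinearMap.comp_apply, LinearEquiv.coe_coe, Fin.val_castSucc]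
    rw [e3, e1, e2, e4]
  have hmat : LinearMap.toMatrix' (φ k.succ).toLinearMap * L k =
      K k * LinearMap.toMatrix' (φ k.castSucc).toLinearMap := by
    have := congrArg LinearMap.toMatrix' hcomm
    simpa only [LinearMap.toMatrix'_comp, ← Matrix.toLin'_apply', LinearMap.toMatrix'_toLin']
      using this
  change (g k.succ : Matrix (Fin N) (Fin N) ℂ) * L k * ((g k.castSucc)⁻¹ : GL (Fin N) ℂ) = K k
  rw [Units.mul_inv_eq_iff_eq_mul]
  exact hmat

/-! ### Zariski closures of orbits -/

theorem subset_zariskiClosure {ℓ N : ℕ} (S : Set (RepSpace ℓ N)) : S ⊆ zariskiClosure S :=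
  fun _ hK _ hp => hp _ hK

/-- A point is in the closure of a set that contains all other points of a line through it. -/
theorem mem_zariskiClosure_of_line {ℓ N : ℕ} {S : Set (RepSpace ℓ N)} (K G : RepSpace ℓ N)
    (h : ∀ c : ℂ, c ≠ 0 → K + c • G ∈ S) : K ∈ zariskiClosure S := by
  intro p hp
  -- The restriction of `p` to the line: a polynomial in one variable vanishing at every `c ≠ 0`,
  -- hence zero.
  let q : Polynomial ℂ := MvPolynomial.aeval (fun x : Fin ℓ × Fin N × Fin N =>
    Polynomial.C (K x.1 x.2.1 x.2.2) + Polynomial.C (G x.1 x.2.1 x.2.2) * Polynomial.X) p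
  have hq : ∀ c : ℂ, q.eval c = MvPolynomial.eval (fun x => (K + c • G) x.1 x.2.1 x.2.2) p := by
    intro c
    rw [← Polynomial.coe_evalRingHom, MvPolynomial.map_aeval,
      show (Polynomial.evalRingHom c).comp (algebraMap ℂ (Polynomial ℂ)) = RingHom.id ℂ by
        ext; simp]
    change MvPolynomial.eval _ p = _
    congr 2
    funext x
    simp
    exact mul_comm _ _
  have hq0 : q = 0 := by
    apply Polynomial.eq_zero_of_infinite_isRoot
    refine Set.Infinite.mono (s := {0}ᶜ) ?_ (Set.finite_singleton (0 : ℂ)).infinite_compl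
    intro c hc
    rw [Set.mem_ofPred_eq, Polynomial.IsRoot, hq c]
    exact hp _ (h c hc)
  have := hq 0
  rw [hq0] at this
  simpa using this.symm

/-- The group acts by polynomial maps preserving the orbit: pulling `p` back along `g` gives a
polynomial `q` that again vanishes on it. -/
theorem baseChange_mem_zariskiClosure {ℓ N : ℕ} {K L : RepSpace ℓ N}
    (h : K ∈ zariskiClosure (orbit L)) (g : Fin (ℓ + 1) → GL (Fin N) ℂ) :
    baseChange g K ∈ zariskiClosure (orbit L) := by
  intro p hp
  let q : MvPolynomial (Fin ℓ × Fin N × Fin N) ℂ := MvPolynomial.aeval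
    (fun x : Fin ℓ × Fin N × Fin N => ∑ j, (∑ i, MvPolynomial.C
      ((g x.1.succ : Matrix (Fin N) (Fin N) ℂ) x.2.1 i) * MvPolynomial.X (x.1, i, j)) *
      MvPolynomial.C (((g x.1.castSucc)⁻¹ : GL (Fin N) ℂ).val j x.2.2)) p
  have hq : ∀ M : RepSpace ℓ N, MvPolynomial.eval (fun x => M x.1 x.2.1 x.2.2) q =
      MvPolynomial.eval (fun x => baseChange g M x.1 x.2.1 x.2.2) p := by
    intro M
    rw [MvPolynomial.map_aeval, show (MvPolynomial.eval fun x : Fin ℓ × Fin N × Fin N =>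
      M x.1 x.2.1 x.2.2).comp (algebraMap ℂ _) = RingHom.id ℂ by ext; simp]
    change MvPolynomial.eval _ p = _
    congr 2
    funext x
    simp [baseChange, Matrix.mul_apply]
  rw [← hq K]
  refine h q ?_
  rintro _ ⟨g', rfl⟩
  rw [hq]
  refine hp _ ⟨fun v => g v * g' v, ?_⟩
  funext k
  simp [baseChange, Matrix.mul_assoc]

theorem zariskiClosure_orbit_trans {ℓ N : ℕ} {K K' L : RepSpace ℓ N}
    (h : K ∈ zariskiClosure (orbit K')) (h' : K' ∈ zariskiClosure (orbit L)) :
    K ∈ zariskiClosure (orbit L) := by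
  intro p hp
  refine h p ?_
  rintro _ ⟨g, rfl⟩
  exact baseChange_mem_zariskiClosure h' g p hp

/-! ### Rank inequalities imply degeneration -/

/-- If two chains can exchange their right ends, the point is a degeneration of a point where
this has happened. -/
theorem ChainBasis.exists_degeneration {ℓ N : ℕ} {K : RepSpace ℓ N} {ι : Type*} [Fintype ι]
    [DecidableEq ι] {a b : ι → ℕ} {x : ι → ℕ → Fin N → ℂ}
    (h : ChainBasis (ext K) (full ℓ N) a b x) {s t : ι} (ha : a s < a t) (hab : a t ≤ b s + 1)
    (hb : b s < b t) (hbt : b t ≤ ℓ) (has : a s ≤ b s) :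
    ∃ (K' : RepSpace ℓ N) (y : ι → ℕ → Fin N → ℂ),
      ChainBasis (ext K') (full ℓ N) a (b ∘ Equiv.swap s t) y ∧
        K ∈ zariskiClosure (orbit K') := by
  obtain ⟨g, hg⟩ := h.exists_linearMap (b s) (fun u => if u = s then x t (b s + 1) else 0)
  have hgs : g (x s (b s)) = x t (b s + 1) := by
    rw [hg s has le_rfl, if_pos rfl]
  have hgu : ∀ u, u ≠ s → g (x u (b s)) = 0 := by
    intro u hu
    by_cases hv : a u ≤ b s ∧ b s ≤ b u
    · rw [hg u hv.1 hv.2, if_neg hu]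
    · rw [h.zero u _ hv, map_zero]
  -- The perturbation lives on the arrow leaving `b s`, which exists because `b s < b t ≤ ℓ`. For
  -- all `c ≠ 0` the point `K + c • G` has the same interval type, so these points share one orbit.
  let G : RepSpace ℓ N := fun k => if (k : ℕ) = b s then LinearMap.toMatrix' g else 0
  have hext : ∀ c : ℂ, ext (K + c • G) = fun v => ext K v + if v = b s then c • g else 0 := by
    intro c
    funext v
    by_cases hv : v < ℓ
    · simp only [ext, dif_pos hv, G, Pi.add_apply, Pi.smul_apply]
      split_ifs with h1
      · rw [← Matrix.toLin'_apply', map_add, map_smul, Matrix.toLin'_toMatrix', Matrix.toLin'_apply']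
      · simp
    · simp only [ext, dif_neg hv]
      rw [if_neg (by omega), add_zero]
  have hex : ∀ c : ℂ, c ≠ 0 → ∃ y, ChainBasis (ext (K + c • G)) (full ℓ N) a
      (b ∘ Equiv.swap s t) y := by
    intro c hc
    rw [hext c]
    exact h.exchange ha hab hb g hgs hgu c hc
  obtain ⟨y, hy⟩ := hex 1 one_ne_zero
  refine ⟨K + (1 : ℂ) • G, y, hy, mem_zariskiClosure_of_line K G fun c hc => ?_⟩
  obtain ⟨z, hz⟩ := hex c hc
  exact hz.mem_orbit hy

/-- Rank inequalities imply degeneration. -/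
theorem mem_zariskiClosure_of_rk_le {ℓ N : ℕ} (K L : RepSpace ℓ N)
    (h : ∀ p d, p + d ≤ ℓ → rk K p d ≤ rk L p d) : K ∈ zariskiClosure (orbit L) := by
  classical
  induction hn : ∑ p ∈ Finset.range (ℓ + 1), ∑ d ∈ Finset.range (ℓ + 1),
      (if p + d ≤ ℓ then N - rk K p d else 0) using Nat.strong_induction_on generalizing K with
  | _ n ih =>
    -- Decompositions are chosen afresh at each induction step: an exchange may leave an empty
    -- interval, which `exists_exchange` does not allow.
    obtain ⟨ι, _, a, b, x, hab, hx⟩ := exists_chainBasis_ext L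
    obtain ⟨κ, _, a', b', x', hab', hx'⟩ := exists_chainBasis_ext K
    have hdiag : ∀ p, cnt a' b' p p = cnt a b p p := fun p => by rw [hx.card, hx'.card]
    have hle : ∀ p q, p ≤ q → cnt a' b' p q ≤ cnt a b p q := by
      intro p q hpq
      by_cases hq : q ≤ ℓ
      · have := h p (q - p) (by omega)
        rwa [hx.rk_eq _ _ (by omega), hx'.rk_eq _ _ (by omega),
          show p + (q - p) = q by omega] at this
      · have : cnt a' b' p q = 0 := by
          rw [cnt, Finset.card_eq_zero, Finset.filter_eq_empty_iff]
          intro s _ hs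
          have := hab' s
          omega
        omega
    by_cases hne : ∃ p q, p ≤ q ∧ cnt a' b' p q < cnt a b p q
    · obtain ⟨s, t, h1, h2, h3, h4⟩ := exists_exchange a b a' b' ℓ (fun s => (hab' s).1)
        (fun s => (hab s).2) hle hdiag hne
      obtain ⟨K', y, hy, hK⟩ := hx'.exists_degeneration h1 h2 h3 (hab' t).2 (hab' s).1
      have hrk : ∀ p d, p + d ≤ ℓ → rk K' p d = rk K p d +
          if a' s ≤ p ∧ p < a' t ∧ b' s < p + d ∧ p + d ≤ b' t then 1 else 0 := by
        intro p d hpd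
        rw [hy.rk_eq p d hpd, hx'.rk_eq p d hpd, cnt_exchange a' b' h1 h3]
      refine zariskiClosure_orbit_trans hK (ih _ ?_ K' ?_ rfl)
      · rw [← hn]
        have hterm : ∀ p d, (if p + d ≤ ℓ then N - rk K' p d else 0) ≤
            (if p + d ≤ ℓ then N - rk K p d else 0) := by
          intro p d
          split_ifs with hpd
          · have := hrk p d hpd
            omega
          · exact le_rfl
        have hbt := (hab' t).2
        apply Finset.sum_lt_sum
        · exact fun p _ => Finset.sum_le_sum fun d _ => hterm p d
        -- The rank from `a' s` to `b' t` grows by one, so the total corank drops.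
        · refine ⟨a' s, Finset.mem_range.2 (by omega), ?_⟩
          apply Finset.sum_lt_sum
          · exact fun d _ => hterm _ d
          · refine ⟨b' t - a' s, Finset.mem_range.2 (by omega), ?_⟩
            rw [if_pos (by omega), if_pos (by omega)]
            have e1 := hrk (a' s) (b' t - a' s) (by omega)
            rw [if_pos (by omega)] at e1
            have e2 := rk_le K' (a' s) (b' t - a' s)
            omega
      · intro p d hpd
        rw [hrk p d hpd]
        split_ifs with hr
        · have := h4 p (p + d) (by omega) hr.1 hr.2.1 hr.2.2.1 hr.2.2.2
          rw [hx.rk_eq p d hpd, hx'.rk_eq p d hpd]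
          exact this
        · exact h p d hpd
    · push Not at hne
      obtain ⟨σ, hσ⟩ := exists_equiv_of_cnt_eq a b a' b' (fun s => (hab s).1)
        (fun s => (hab' s).1) (fun p q hpq => le_antisymm (hle p q hpq) (hne p q hpq))
      have hx2 := hx.reindex σ
      rw [show a ∘ σ = a' from funext fun s => (hσ s).1,
        show b ∘ σ = b' from funext fun s => (hσ s).2] at hx2
      exact subset_zariskiClosure _ (hx'.mem_orbit hx2)

/-! ### Realising direct sums of intervals as points, and their ranks -/

theorem QRep.Isom.refl {ℓ : ℕ} (A : QRep ℓ) : A.Isom A :=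
  ⟨fun _ => LinearEquiv.refl ℂ _, fun _ _ => rfl⟩

/-- A representation of dimension vector `(N, …, N)` is isomorphic to a point of `R_d`. -/
theorem exists_toQRep_isom {ℓ N : ℕ} (A : QRep ℓ) [∀ v, FiniteDimensional ℂ (A.space v)]
    (hA : ∀ v, finrank ℂ (A.space v) = N) : ∃ K : RepSpace ℓ N, K.toQRep.Isom A := by
  have hφ : ∀ v, Nonempty ((Fin N → ℂ) ≃ₗ[ℂ] A.space v) := fun v =>
    FiniteDimensional.nonempty_linearEquiv_of_finrank_eq (by simp [hA v])
  have φ := fun v => Classical.choice (hφ v)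
  refine ⟨fun k => LinearMap.toMatrix'
    ((φ k.succ).symm.toLinearMap ∘ₗ A.map k ∘ₗ (φ k.castSucc).toLinearMap), φ, fun k x => ?_⟩
  change φ k.succ (Matrix.mulVecLin (LinearMap.toMatrix' _) x) = _
  rw [← Matrix.toLin'_apply', Matrix.toLin'_toMatrix']
  exact (φ k.succ).apply_symm_apply _

theorem finrank_directSum_interval {ℓ : ℕ} {ι : Type} [Fintype ι] (α β : ι → Fin (ℓ + 1))
    (v : Fin (ℓ + 1)) :
    finrank ℂ ((directSum fun s => interval (α s) (β s)).space v) =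
      cnt (fun s => (α s : ℕ)) (fun s => (β s : ℕ)) v v := by
  classical
  change finrank ℂ (∀ s, PLift (α s ≤ v ∧ v ≤ β s) → ℂ) = _
  rw [Module.finrank_pi_fintype, cnt, Finset.card_filter]
  refine Finset.sum_congr rfl fun s _ => ?_
  rw [Module.finrank_fintype_fun_eq_card]
  by_cases h : α s ≤ v ∧ v ≤ β s
  · rw [if_pos (show (α s : ℕ) ≤ v ∧ (v : ℕ) ≤ β s from h)]
    have : Unique (PLift (α s ≤ v ∧ v ≤ β s)) := ⟨⟨⟨h⟩⟩, fun x => by cases x; rfl⟩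
    exact Fintype.card_unique
  · rw [if_neg (show ¬ ((α s : ℕ) ≤ v ∧ (v : ℕ) ≤ β s) from h)]
    have : IsEmpty (PLift (α s ≤ v ∧ v ≤ β s)) := ⟨fun x => h x.down⟩
    exact Fintype.card_eq_zero

/-- The basis vector of the summand `s` of a direct sum of intervals. -/
def unitVec {ℓ : ℕ} {ι : Type} [Fintype ι] [DecidableEq ι] (α β : ι → Fin (ℓ + 1)) (s : ι)
    (v : Fin (ℓ + 1)) : (directSum fun s => interval (α s) (β s)).space v :=
  fun t _ => if t = s then 1 else 0

theorem unitVec_eq_zero {ℓ : ℕ} {ι : Type} [Fintype ι] [DecidableEq ι] (α β : ι → Fin (ℓ + 1))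
    (s : ι) (v : Fin (ℓ + 1)) (h : ¬ (α s ≤ v ∧ v ≤ β s)) : unitVec α β s v = 0 := by
  funext t y
  change (if t = s then (1 : ℂ) else 0) = 0
  rw [if_neg]
  rintro rfl
  exact h y.down

theorem map_unitVec {ℓ : ℕ} {ι : Type} [Fintype ι] [DecidableEq ι] (α β : ι → Fin (ℓ + 1))
    (s : ι) (k : Fin ℓ) (h : α s ≤ k.castSucc) :
    (directSum fun s => interval (α s) (β s)).map k (unitVec α β s k.castSucc) =
      unitVec α β s k.succ := by
  funext t y
  change (if h : α t ≤ k.castSucc ∧ k.castSucc ≤ β t then (if t = s then (1 : ℂ) else 0) else 0) =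
    if t = s then (1 : ℂ) else 0
  by_cases hts : t = s
  · subst hts
    rw [dif_pos ⟨h, k.castSucc_lt_succ.le.trans y.down.2⟩]
  · simp [hts]

theorem sum_unitVec {ℓ : ℕ} {ι : Type} [Fintype ι] [DecidableEq ι] (α β : ι → Fin (ℓ + 1))
    (v : Fin (ℓ + 1)) (z : (directSum fun s => interval (α s) (β s)).space v) :
    ∃ c : ι → ℂ, z = ∑ s, c s • unitVec α β s v := by
  classical
  have key : ∀ z : (∀ s, PLift (α s ≤ v ∧ v ≤ β s) → ℂ), ∃ c : ι → ℂ,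
      z = ∑ s, c s • (fun t _ => if t = s then 1 else 0 :
        ∀ t, PLift (α t ≤ v ∧ v ≤ β t) → ℂ) := by
    intro z
    refine ⟨fun s => if h : α s ≤ v ∧ v ≤ β s then z s ⟨h⟩ else 0, ?_⟩
    funext t y
    rw [Finset.sum_apply, Finset.sum_apply]
    simp only [Pi.smul_apply, smul_eq_mul, mul_ite, mul_one, mul_zero, Finset.sum_ite_eq,
      Finset.mem_univ, if_true]
    rw [dif_pos y.down]
  exact key z

theorem exists_chainBasis_of_isom {ℓ N : ℕ} {ι : Type} [Fintype ι] (α β : ι → Fin (ℓ + 1))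
    (K : RepSpace ℓ N) (h : K.toQRep.Isom (directSum fun s => interval (α s) (β s))) :
    ∃ x, ChainBasis (ext K) (full ℓ N) (fun s => (α s : ℕ)) (fun s => (β s : ℕ)) x := by
  classical
  obtain ⟨φ, hφ⟩ := h
  let φ' : ∀ v : Fin (ℓ + 1), (Fin N → ℂ) ≃ₗ[ℂ]
    (directSum fun s => interval (α s) (β s)).space v := φ
  let x : ι → ℕ → Fin N → ℂ := fun s v =>
    if hv : v < ℓ + 1 then (φ' ⟨v, hv⟩).symm (unitVec α β s ⟨v, hv⟩) else 0
  have hx : ∀ s (v : ℕ) (hv : v < ℓ + 1),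
      x s v = (φ' ⟨v, hv⟩).symm (unitVec α β s ⟨v, hv⟩) := fun s v hv => dif_pos hv
  refine ⟨x, ⟨?_, ?_, ?_, ?_⟩⟩
  · intro s v hsv
    by_cases hv : v < ℓ + 1
    · rw [hx s v hv, unitVec_eq_zero α β s ⟨v, hv⟩ hsv, map_zero]
    · exact dif_neg hv
  · intro s v hsv
    by_cases hv : v < ℓ
    · rw [hx s v (by omega), hx s (v + 1) (by omega), ext, dif_pos hv, LinearEquiv.eq_symm_apply]
      have h1 := hφ ⟨v, hv⟩ ((φ' ⟨v, by omega⟩).symm (unitVec α β s ⟨v, by omega⟩))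
      refine h1.trans ?_
      have h2 := map_unitVec α β s ⟨v, hv⟩ hsv
      refine Eq.trans ?_ h2
      congr 1
      exact (φ' ⟨v, by omega⟩).apply_symm_apply _
    · rw [ext, dif_neg hv, LinearMap.zero_apply]
      simp only [x]
      rw [dif_neg (by omega)]
  · intro v
    by_cases hv : v < ℓ + 1
    · have := (φ' ⟨v, hv⟩).finrank_eq
      rw [finrank_directSum_interval] at this
      rw [← this, full, if_pos (by omega)]
      simp
    · rw [full, if_neg (by omega), finrank_bot, cnt, Finset.card_eq_zero,
        Finset.filter_eq_empty_iff]
      intro s _ hs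
      have := (β s).2
      omega
  · intro v
    by_cases hv : v < ℓ + 1
    · rw [full, if_pos (by omega), eq_top_iff]
      intro y _
      obtain ⟨c, hc⟩ := sum_unitVec α β ⟨v, hv⟩ (φ' ⟨v, hv⟩ y)
      have : y = ∑ s, c s • x s v := by
        rw [← (φ' ⟨v, hv⟩).symm_apply_apply y, hc, map_sum]
        refine Finset.sum_congr rfl fun s _ => ?_
        rw [map_smul, hx s v hv]
      rw [this]
      exact sum_mem fun s _ => smul_mem _ _ (subset_span ⟨s, rfl⟩)
    · rw [full, if_neg (by omega), span_eq_bot]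
      rintro _ ⟨s, rfl⟩
      exact dif_neg hv

/-- The right side runs over all pairs; `p ≤ q` removes those with `j < i`, which `ofMult` ignores.
-/
theorem cnt_ofMult {ℓ : ℕ} (m : Fin (ℓ + 1) → Fin (ℓ + 1) → ℕ) (p q : ℕ) (hpq : p ≤ q) :
    cnt (fun s : (Σ p : {p : Fin (ℓ + 1) × Fin (ℓ + 1) // p.1 ≤ p.2}, Fin (m p.1.1 p.1.2)) =>
        (s.1.1.1 : ℕ)) (fun s => (s.1.1.2 : ℕ)) p q =
      ∑ i : Fin (ℓ + 1), ∑ j : Fin (ℓ + 1),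
        if (i : ℕ) ≤ p ∧ q ≤ (j : ℕ) then m i j else 0 := by
  classical
  rw [cnt, Finset.card_filter, Fintype.sum_sigma, ← Fintype.sum_prod_type']
  have h1 : ∀ r : {r : Fin (ℓ + 1) × Fin (ℓ + 1) // r.1 ≤ r.2},
      (∑ _ : Fin (m r.1.1 r.1.2), if (r.1.1 : ℕ) ≤ p ∧ q ≤ (r.1.2 : ℕ) then 1 else 0) =
        if (r.1.1 : ℕ) ≤ p ∧ q ≤ (r.1.2 : ℕ) then m r.1.1 r.1.2 else 0 := by
    intro r
    split_ifs <;> simp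
  rw [Finset.sum_congr rfl fun r _ => h1 r,
    ← Finset.sum_subtype (Finset.univ.filter fun r : Fin (ℓ + 1) × Fin (ℓ + 1) => r.1 ≤ r.2)
      (by simp) (fun r => if (r.1 : ℕ) ≤ p ∧ q ≤ (r.2 : ℕ) then m r.1 r.2 else 0)]
  refine Finset.sum_filter_of_ne fun r _ hr => ?_
  rw [Fin.le_def]
  by_contra hlt
  exact hr (if_neg (by omega))

/-- `hm` says that the dimension is `N` at every vertex. -/
theorem exists_isom_ofMult {ℓ N : ℕ} (m : Fin (ℓ + 1) → Fin (ℓ + 1) → ℕ)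
    (hm : ∀ v, v ≤ ℓ → (∑ i : Fin (ℓ + 1), ∑ j : Fin (ℓ + 1),
      if (i : ℕ) ≤ v ∧ v ≤ (j : ℕ) then m i j else 0) = N) :
    ∃ K : RepSpace ℓ N, K.toQRep.Isom (ofMult m) ∧ ∀ p d, p + d ≤ ℓ →
      rk K p d = ∑ i : Fin (ℓ + 1), ∑ j : Fin (ℓ + 1),
        if (i : ℕ) ≤ p ∧ p + d ≤ (j : ℕ) then m i j else 0 := by
  have : ∀ v, FiniteDimensional ℂ ((ofMult m).space v) := fun v =>
    inferInstanceAs (FiniteDimensional ℂ (∀ s : (Σ p : {p : Fin (ℓ + 1) × Fin (ℓ + 1) //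
      p.1 ≤ p.2}, Fin (m p.1.1 p.1.2)), PLift (s.1.1.1 ≤ v ∧ v ≤ s.1.1.2) → ℂ))
  obtain ⟨K, hK⟩ := exists_toQRep_isom (N := N) (ofMult m) fun v => by
    rw [ofMult, finrank_directSum_interval, cnt_ofMult m v v le_rfl, hm v (by omega)]
  refine ⟨K, hK, fun p d hpd => ?_⟩
  obtain ⟨x, hx⟩ := exists_chainBasis_of_isom _ _ K hK
  rw [hx.rk_eq p d hpd, cnt_ofMult m p (p + d) (by omega)]

/-! ### Coranks of M(a) and M^2 as sums over arrows -/

/-- The sum of the entries of `a` at the arrows between the vertices `p` and `q`. -/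
def arrowSum {ℓ : ℕ} (a : Fin ℓ → ℕ) (p q : ℕ) : ℕ :=
  ∑ k : Fin ℓ, if p ≤ (k : ℕ) ∧ (k : ℕ) < q then a k else 0

/-- A pair of summands cut at arrow `k` contributes one interval containing both `p` and `q`, unless
the cut lies between them, when it contributes none. The corank thus counts these cuts. -/
theorem sum_multA {ℓ N : ℕ} (a : Fin ℓ → ℕ) (ha : ∑ k, a k ≤ N) (p q : ℕ) (hpq : p ≤ q)
    (hq : q ≤ ℓ) :
    (∑ i : Fin (ℓ + 1), ∑ j : Fin (ℓ + 1),
      if (i : ℕ) ≤ p ∧ q ≤ (j : ℕ) then multA N a i j else 0) + arrowSum a p q = N := by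
  have h1 : multA N a 0 (Fin.last ℓ) = N - ∑ k, a k := by simp [multA]
  have h2 : ∀ j : Fin ℓ, multA N a 0 j.castSucc = a j := fun j => by
    simp [multA, Fin.castSucc_ne_last]
  have h3 : ∀ i : Fin ℓ, multA N a i.succ (Fin.last ℓ) = a i := fun i => by
    simp [multA, Fin.succ_ne_zero]
  have h4 : ∀ i j : Fin ℓ, multA N a i.succ j.castSucc = 0 := fun i j => by
    simp [multA, Fin.succ_ne_zero, Fin.castSucc_ne_last]
  rw [Fin.sum_univ_succ]
  simp only [Fin.sum_univ_castSucc, h1, h2, h3,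
    h4, Fin.val_zero, Fin.val_last, Fin.val_castSucc, Fin.val_succ, Nat.zero_le, true_and, hq,
    and_true, if_true, ite_self, Finset.sum_const_zero, zero_add]
  have h5 : ∑ k, a k = (∑ k : Fin ℓ, if q ≤ (k : ℕ) then a k else 0) +
      (∑ k : Fin ℓ, if (k : ℕ) + 1 ≤ p then a k else 0) + arrowSum a p q := by
    rw [arrowSum, ← Finset.sum_add_distrib, ← Finset.sum_add_distrib]
    refine Finset.sum_congr rfl fun k _ => ?_
    split_ifs <;> omega
  omega

theorem sum_diagonal {ℓ : ℕ} (p q : ℕ) (hpq : p ≤ q) (hq : q ≤ ℓ) :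
    (∑ i : Fin (ℓ + 1), ∑ j : Fin (ℓ + 1),
      if (i : ℕ) ≤ p ∧ q ≤ (j : ℕ) then (if i = j then 1 else 0) else 0) =
      if p = q then 1 else 0 := by
  have : ∀ i j : Fin (ℓ + 1),
      (if (i : ℕ) ≤ p ∧ q ≤ (j : ℕ) then (if i = j then 1 else 0) else 0) =
      if i = j then (if (i : ℕ) ≤ p ∧ q ≤ (i : ℕ) then 1 else 0) else 0 := by
    intro i j
    by_cases hij : i = j
    · subst hij
      simp
    · simp [hij]
  simp only [this, Finset.sum_ite_eq, Finset.mem_univ, if_true]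
  by_cases hp : p = q
  · subst hp
    rw [if_pos rfl, Finset.sum_eq_single (⟨p, by omega⟩ : Fin (ℓ + 1))]
    · simp
    · intro i _ hi
      rw [if_neg]
      intro h
      exact hi (Fin.ext (by simp; omega))
    · simp
  · rw [if_neg hp]
    refine Finset.sum_eq_zero fun i _ => if_neg (by omega)

/-- The simple summands count only for `p = q`, where they make up for `N - 1`; elsewhere the corank
is one more than for M^1. -/
theorem sum_mult2 {ℓ N : ℕ} (hN : 1 ≤ N) (e : Fin (ℓ + 1) → ℕ)
    (he : ∑ k, diff e k ≤ N - 1) (p q : ℕ) (hpq : p ≤ q)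
    (hq : q ≤ ℓ) :
    (∑ i : Fin (ℓ + 1), ∑ j : Fin (ℓ + 1),
      if (i : ℕ) ≤ p ∧ q ≤ (j : ℕ) then mult2 N e i j else 0) + arrowSum (diff e) p q +
      (if p = q then 0 else 1) = N := by
  have h1 := sum_multA (diff e) he p q hpq hq
  have h2 := sum_diagonal (ℓ := ℓ) p q hpq hq
  have h3 : (∑ i : Fin (ℓ + 1), ∑ j : Fin (ℓ + 1),
      if (i : ℕ) ≤ p ∧ q ≤ (j : ℕ) then mult2 N e i j else 0) =
      (∑ i : Fin (ℓ + 1), ∑ j : Fin (ℓ + 1),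
        if (i : ℕ) ≤ p ∧ q ≤ (j : ℕ) then multA (N - 1) (diff e) i j else 0) +
      (∑ i : Fin (ℓ + 1), ∑ j : Fin (ℓ + 1),
        if (i : ℕ) ≤ p ∧ q ≤ (j : ℕ) then (if i = j then 1 else 0) else 0) := by
    simp only [← Finset.sum_add_distrib]
    refine Finset.sum_congr rfl fun i _ => Finset.sum_congr rfl fun j _ => ?_
    rw [mult2]
    split_ifs <;> rfl
  rw [h3, h2]
  split_ifs <;> omega

theorem arrowSum_self {ℓ : ℕ} (a : Fin ℓ → ℕ) (p : ℕ) : arrowSum a p p = 0 :=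
  Finset.sum_eq_zero fun k _ => if_neg (by omega)

theorem arrowSum_zero_last {ℓ : ℕ} (a : Fin ℓ → ℕ) : arrowSum a 0 ℓ = ∑ k, a k :=
  Finset.sum_congr rfl fun k _ => if_pos (by omega)

/-- `e` as a function on the natural numbers. -/
def natExt {ℓ : ℕ} (e : Fin (ℓ + 1) → ℕ) (v : ℕ) : ℕ := e ⟨min v ℓ, by omega⟩

theorem natExt_mono {ℓ : ℕ} {e : Fin (ℓ + 1) → ℕ} (he : Monotone e) : Monotone (natExt e) :=
  fun v w hvw => he (by
    rw [Fin.mk_le_mk]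
    omega)

theorem diff_eq {ℓ : ℕ} (e : Fin (ℓ + 1) → ℕ) (k : Fin ℓ) :
    diff e k = natExt e (k + 1) - natExt e k := by
  rw [diff, natExt, natExt]
  congr 2
  · ext
    simp
  · ext
    simp

theorem arrowSum_diff {ℓ : ℕ} {e : Fin (ℓ + 1) → ℕ} (he : Monotone e) (p q : ℕ) (hpq : p ≤ q)
    (hq : q ≤ ℓ) : arrowSum (diff e) p q = natExt e q - natExt e p := by
  induction q, hpq using Nat.le_induction with
  | base => rw [arrowSum_self, Nat.sub_self]
  | succ q hpq ih =>
    have h1 : arrowSum (diff e) p (q + 1) = arrowSum (diff e) p q + diff e ⟨q, by omega⟩ := by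
      have : diff e ⟨q, by omega⟩ = ∑ k : Fin ℓ, if (⟨q, by omega⟩ : Fin ℓ) = k then diff e k else 0 := by
        simp
      rw [this, arrowSum, arrowSum, ← Finset.sum_add_distrib]
      refine Finset.sum_congr rfl fun k _ => ?_
      simp only [Fin.ext_iff]
      split_ifs <;> omega
    rw [h1, ih (by omega), diff_eq]
    have h2 := natExt_mono he hpq
    have h3 := natExt_mono he (Nat.le_succ q)
    simp only [Nat.succ_eq_add_one] at h3
    simp only
    omega

/-! ### Coranks of M and the numerical argument -/

/-- The corank of the composite map from the vertex `p` to the vertex `q`. -/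
def corank {ℓ N : ℕ} (M : RepSpace ℓ N) (p q : ℕ) : ℕ := N - rk M p (q - p)

theorem corank_self {ℓ N : ℕ} (M : RepSpace ℓ N) (p : ℕ) : corank M p p = 0 := by
  rw [corank, Nat.sub_self, rk]
  change N - finrank ℂ (LinearMap.range (LinearMap.id : (Fin N → ℂ) →ₗ[ℂ] _)) = 0
  rw [LinearMap.range_id, finrank_top]
  simp

/-- Sylvester's rank inequality: the kernel of the second map restricted to the image of the first
is no larger than its whole kernel. -/
theorem corank_triangle {ℓ N : ℕ} (M : RepSpace ℓ N) (p q r : ℕ) (hpq : p ≤ q) (hqr : q ≤ r) :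
    corank M p r ≤ corank M p q + corank M q r := by
  have h1 := rk_le M p (q - p)
  have h2 := rk_le M q (r - q)
  have h3 : rk M p (q - p) + rk M q (r - q) ≤ rk M p (r - p) + N := by
    have hc := comp_add (ext M) p (q - p) (r - q)
    rw [show p + (q - p) = q by omega, show q - p + (r - q) = r - p by omega] at hc
    set A := comp (ext M) p (q - p) with hA
    set B := comp (ext M) q (r - q) with hB
    rw [rk, rk, rk, hc, ← hA, ← hB, LinearMap.range_comp]
    have e1 := (B.domRestrict (LinearMap.range A)).finrank_range_add_finrank_ker
    have e2 := B.finrank_range_add_finrank_ker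
    have e3 : finrank ℂ (LinearMap.ker (B.domRestrict (LinearMap.range A))) ≤
        finrank ℂ (LinearMap.ker B) := by
      rw [LinearMap.ker_domRestrict]
      have : ((LinearMap.ker B).comap (LinearMap.range A).subtype).map (LinearMap.range A).subtype ≤
          LinearMap.ker B := Submodule.map_comap_le _ _
      have h := Submodule.finrank_mono this
      rwa [Submodule.finrank_map_subtype_eq] at h
    rw [LinearMap.range_domRestrict] at e1
    rw [Module.finrank_fin_fun] at e2
    omega
  rw [corank, corank, corank]
  omega

theorem corank_mono {ℓ N : ℕ} (M : RepSpace ℓ N) {p p' q' q : ℕ} (hp : p ≤ p') (hpq : p' ≤ q')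
    (hq : q' ≤ q) : corank M p' q' ≤ corank M p q := by
  have h1 : rk M p (q - p) ≤ rk M p (q' - p) := by
    have hc := comp_add (ext M) p (q' - p) (q - q')
    rw [show q' - p + (q - q') = q - p by omega] at hc
    rw [rk, rk, hc, LinearMap.range_comp]
    exact Submodule.finrank_map_le _ _
  have h2 : rk M p (q' - p) ≤ rk M p' (q' - p') := by
    have hc := comp_add (ext M) p (p' - p) (q' - p')
    rw [show p + (p' - p) = p' by omega, show p' - p + (q' - p') = q' - p by omega] at hc
    rw [rk, rk, hc]
    exact Submodule.finrank_mono (LinearMap.range_comp_le_range _ _)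
  rw [corank, corank]
  omega

/-- Sufficiently large coranks make a point a degeneration of `M(a)`. -/
theorem degenerates_repA {ℓ N : ℕ} (a : Fin ℓ → ℕ) (M : RepSpace ℓ N)
    (h : ∀ p q, p ≤ q → q ≤ ℓ → arrowSum a p q ≤ corank M p q) :
    ∑ k, a k ≤ N ∧ Degenerates N (repA N a) M.toQRep := by
  -- The sum of all entries is the arrow sum from first to last vertex, and a corank is at most `N`.
  have ha : ∑ k, a k ≤ N := by
    rw [← arrowSum_zero_last]
    exact (h 0 ℓ (Nat.zero_le _) le_rfl).trans (Nat.sub_le _ _)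
  refine ⟨ha, ?_⟩
  obtain ⟨K, hK, hrk⟩ := exists_isom_ofMult (N := N) (multA N a) fun v hv => by
    have := sum_multA a ha v v le_rfl hv
    rwa [arrowSum_self, add_zero] at this
  refine ⟨K, M, hK, QRep.Isom.refl _, mem_zariskiClosure_of_rk_le M K fun p d hpd => ?_⟩
  have h1 := sum_multA a ha p (p + d) (by omega) hpd
  rw [← hrk p d hpd] at h1
  have h2 := h p (p + d) (by omega) hpd
  rw [corank, Nat.add_sub_cancel_left] at h2
  have h3 := rk_le M p d
  omega

theorem sum_diff_le {ℓ N : ℕ} {e : Fin (ℓ + 1) → ℕ} (he : Monotone e) (he_first : 1 ≤ e 0)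
    (he_last : e (Fin.last ℓ) ≤ N) : ∑ k, diff e k ≤ N - 1 := by
  rw [← arrowSum_zero_last, arrowSum_diff he 0 ℓ (Nat.zero_le _) le_rfl]
  have h1 : natExt e ℓ = e (Fin.last ℓ) := congrArg e (Fin.ext (by simp))
  have h2 : natExt e 0 = e 0 := congrArg e (Fin.ext (by simp))
  omega

theorem exists_corank_of_not_degenerates_rep1 {ℓ N : ℕ} {e : Fin (ℓ + 1) → ℕ} (he : Monotone e)
    (he_first : 1 ≤ e 0) (he_last : e (Fin.last ℓ) ≤ N) (M : RepSpace ℓ N)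
    (h : ¬ Degenerates N M.toQRep (rep1 N e)) :
    ∃ p q, p ≤ q ∧ q ≤ ℓ ∧ natExt e q - natExt e p < corank M p q := by
  by_contra hcon
  push Not at hcon
  apply h
  have ha : ∑ k, diff e k ≤ N := (sum_diff_le he he_first he_last).trans (Nat.sub_le _ _)
  obtain ⟨K, hK, hrk⟩ := exists_isom_ofMult (N := N) (multA N (diff e)) fun v hv => by
    have := sum_multA (diff e) ha v v le_rfl hv
    rwa [arrowSum_self, add_zero] at this
  refine ⟨M, K, QRep.Isom.refl _, hK, mem_zariskiClosure_of_rk_le K M fun p d hpd => ?_⟩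
  have h1 := sum_multA (diff e) ha p (p + d) (by omega) hpd
  rw [← hrk p d hpd, arrowSum_diff he p (p + d) (by omega) hpd] at h1
  have h2 := hcon p (p + d) (by omega) hpd
  rw [corank, Nat.add_sub_cancel_left] at h2
  omega

/-- By the rank criterion some corank of M exceeds that of M^2, which is e_q - e_p + 1 for `p < q`;
for `p = q` both vanish. -/
theorem exists_corank_of_not_degenerates_rep2 {ℓ N : ℕ} (hN : 1 ≤ N) {e : Fin (ℓ + 1) → ℕ}
    (he : Monotone e)
    (he_first : 1 ≤ e 0) (he_last : e (Fin.last ℓ) ≤ N) (M : RepSpace ℓ N)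
    (h : ¬ Degenerates N M.toQRep (rep2 N e)) :
    ∃ p q, p < q ∧ q ≤ ℓ ∧ natExt e q - natExt e p + 2 ≤ corank M p q := by
  by_contra hcon
  push Not at hcon
  apply h
  have ha := sum_diff_le he he_first he_last
  obtain ⟨K, hK, hrk⟩ := exists_isom_ofMult (N := N) (mult2 N e) fun v hv => by
    have := sum_mult2 hN e ha v v le_rfl hv
    rwa [arrowSum_self, if_pos rfl] at this
  refine ⟨M, K, QRep.Isom.refl _, hK, mem_zariskiClosure_of_rk_le K M fun p d hpd => ?_⟩
  have h1 := sum_mult2 hN e ha p (p + d) (by omega) hpd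
  rw [← hrk p d hpd, arrowSum_diff he p (p + d) (by omega) hpd] at h1
  rcases Nat.eq_zero_or_pos d with rfl | hd
  · have h2 := corank_self M p
    rw [corank, Nat.sub_self] at h2
    omega
  · rw [if_neg (by omega)] at h1
    have h2 := hcon p (p + d) (by omega) hpd
    rw [corank, Nat.add_sub_cancel_left] at h2
    omega

/-- Coranks are subadditive and e_q - e_p is additive, so bounds at all arrows would add up to a
bound from `p` to `q`. -/
theorem exists_arrow_corank {ℓ N : ℕ} {e : Fin (ℓ + 1) → ℕ} (he : Monotone e) (M : RepSpace ℓ N)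
    {p q : ℕ} (hpq : p ≤ q) (hq : q ≤ ℓ) (h : natExt e q - natExt e p < corank M p q) :
    ∃ i : Fin ℓ, diff e i < corank M i (i + 1) := by
  by_contra hcon
  push Not at hcon
  apply h.not_ge
  clear h
  induction q, hpq using Nat.le_induction with
  | base => rw [corank_self]; exact Nat.zero_le _
  | succ q hpq ih =>
    have h1 := ih (by omega)
    have h2 := hcon ⟨q, by omega⟩
    rw [diff_eq] at h2
    have h3 := corank_triangle M p q (q + 1) hpq (Nat.le_succ q)
    have h4 := natExt_mono he hpq
    have h5 := natExt_mono he (Nat.le_add_right q 1)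
    simp only at h2
    omega

theorem arrowSum_tupI_le {ℓ N : ℕ} (e : Fin (ℓ + 1) → ℕ) (M : RepSpace ℓ N) (i : Fin ℓ)
    (hi : diff e i < corank M i (i + 1)) (p q : ℕ) :
    arrowSum (tupI e i) p q ≤ corank M p q := by
  have h1 : arrowSum (tupI e i) p q = if p ≤ (i : ℕ) ∧ (i : ℕ) < q then diff e i + 1 else 0 := by
    rw [arrowSum, Finset.sum_eq_single i]
    · simp [tupI]
    · intro k _ hk
      simp [tupI, hk]
    · simp
  rw [h1]
  split_ifs with h
  · exact hi.trans_le (corank_mono M h.1 (by omega) h.2)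
  · exact Nat.zero_le _

/-- The sum of differences telescopes over the overlap of `[p, q]` and `[i, j]`. The extra units sit
at the first and last arrow of `[i, j]`, which lie in the nonempty overlap exactly when `p ≤ i`,
respectively `j ≤ q`. -/
theorem arrowSum_tupIJ {ℓ : ℕ} {e : Fin (ℓ + 1) → ℕ} (he : Monotone e) (i j : Fin (ℓ + 1))
    (p q : ℕ) (hpq : max p i < min q j) :
    arrowSum (tupIJ e i j) p q = natExt e (min q j) - natExt e (max p i) +
      (if p ≤ i then 1 else 0) + (if j ≤ q then 1 else 0) := by
  have hj := j.2
  rw [← arrowSum_diff he _ _ hpq.le (by omega)]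
  have h1 : (if p ≤ (i : ℕ) then 1 else 0) = ∑ k : Fin ℓ,
      if (⟨i, by omega⟩ : Fin ℓ) = k then (if p ≤ (k : ℕ) then 1 else 0) else 0 := by
    simp
  have h2 : (if (j : ℕ) ≤ q then 1 else 0) = ∑ k : Fin ℓ,
      if (⟨j - 1, by omega⟩ : Fin ℓ) = k then (if (k : ℕ) < q then 1 else 0) else 0 := by
    simp only [Finset.sum_ite_eq, Finset.mem_univ, if_true]
    congr 1
    rw [eq_iff_iff]
    omega
  rw [h1, h2, arrowSum, arrowSum, ← Finset.sum_add_distrib, ← Finset.sum_add_distrib]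
  refine Finset.sum_congr rfl fun k _ => ?_
  simp only [tupIJ, Fin.ext_iff, Fin.le_def, Fin.val_castSucc, Fin.val_succ]
  split_ifs <;> omega

theorem arrowSum_tupIJ_eq_zero {ℓ : ℕ} (e : Fin (ℓ + 1) → ℕ) (i j : Fin (ℓ + 1))
    (p q : ℕ) (hpq : min q j ≤ max p i) : arrowSum (tupIJ e i j) p q = 0 := by
  refine Finset.sum_eq_zero fun k _ => ?_
  simp only [tupIJ, Fin.le_def, Fin.val_castSucc, Fin.val_succ]
  split_ifs <;> omega

theorem exists_arrowSum_tupIJ_le {ℓ N : ℕ} {e : Fin (ℓ + 1) → ℕ} (he : Monotone e)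
    (M : RepSpace ℓ N)
    (h : ∃ p q, p < q ∧ q ≤ ℓ ∧ natExt e q - natExt e p + 2 ≤ corank M p q) :
    ∃ i j : Fin (ℓ + 1), i < j ∧ ∀ p q, arrowSum (tupIJ e i j) p q ≤ corank M p q := by
  classical
  -- Choose an interval of minimal length `d` with excess at least 2 over the increment of `e`; by
  -- `hmin` all shorter ones have excess at most 1.
  have hex : ∃ d, ∃ i, 0 < d ∧ i + d ≤ ℓ ∧
      natExt e (i + d) - natExt e i + 2 ≤ corank M i (i + d) := by
    obtain ⟨p, q, hpq, hq, hc⟩ := h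
    refine ⟨q - p, p, by omega, by omega, ?_⟩
    rwa [show p + (q - p) = q by omega]
  obtain ⟨i, hd, hid, hc⟩ := Nat.find_spec hex
  set d := Nat.find hex with hdef
  have hmin : ∀ p q, p ≤ q → q ≤ ℓ → q - p < d →
      corank M p q ≤ natExt e q - natExt e p + 1 := by
    intro p q hpq hq hlt
    rcases hpq.eq_or_lt with rfl | hpq
    · rw [corank_self]
      exact Nat.zero_le _
    have := Nat.find_min hex hlt
    push Not at this
    have := this p (by omega) (by omega)
    rw [show p + (q - p) = q by omega] at this
    omega
  refine ⟨⟨i, by omega⟩, ⟨i + d, by omega⟩, by rw [Fin.mk_lt_mk]; omega, fun p q => ?_⟩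
  by_cases hpq : max p i < min q (i + d)
  · rw [arrowSum_tupIJ he _ _ p q hpq]
    simp only
    obtain ⟨p', hp'⟩ : ∃ p', p' = max p i := ⟨_, rfl⟩
    obtain ⟨q', hq'⟩ : ∃ q', q' = min q (i + d) := ⟨_, rfl⟩
    rw [← hp', ← hq']
    rw [← hp', ← hq'] at hpq
    have h1 : corank M p' q' ≤ corank M p q := corank_mono M (by omega) hpq.le (by omega)
    have h2 := corank_triangle M i p' (i + d) (by omega) (by omega)
    have h3 := corank_triangle M p' q' (i + d) (by omega) (by omega)
    have m1 : natExt e i ≤ natExt e p' := natExt_mono he (by omega)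
    have m2 : natExt e p' ≤ natExt e q' := natExt_mono he (by omega)
    have m3 : natExt e q' ≤ natExt e (i + d) := natExt_mono he (by omega)
    -- The piece to the left of the overlap uses up at most 1 of the excess 2, and none if it is
    -- empty, which is when the unit at arrow `i` is counted; `h5` is the same on the right. What
    -- remains is the required bound on the overlap.
    have h4 : corank M i p' + (if p ≤ i then 1 else 0) ≤ natExt e p' - natExt e i + 1 := by
      split_ifs with hpi
      · rw [show p' = i by omega, corank_self]
        omega
      · have := hmin i p' (by omega) (by omega) (by omega)
        omega
    have h5 : corank M q' (i + d) + (if i + d ≤ q then 1 else 0) ≤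
        natExt e (i + d) - natExt e q' + 1 := by
      split_ifs with hqj
      · rw [show q' = i + d by omega, corank_self]
        omega
      · have := hmin q' (i + d) (by omega) (by omega) (by omega)
        omega
    omega
  · rw [arrowSum_tupIJ_eq_zero e _ _ p q (not_lt.1 hpq)]
    exact Nat.zero_le _

end TypeA
end

theorem mainTheorem9 (ℓ N : ℕ) (hN : ℓ + 2 ≤ N)
    (e : Fin (ℓ + 1) → ℕ) (he : Monotone e) (he_first : 1 ≤ e 0) (he_last : e (Fin.last ℓ) ≤ N)
    (M : TypeA.RepSpace ℓ N) :
    (TypeA.Degenerates N M.toQRep (TypeA.rep2 N e) →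
      ¬ TypeA.Degenerates N M.toQRep (TypeA.rep1 N e) →
      ∃ i : Fin ℓ, ∑ k, TypeA.tupI e i k ≤ N ∧
        TypeA.Degenerates N (TypeA.repA N (TypeA.tupI e i)) M.toQRep) ∧
    (¬ TypeA.Degenerates N M.toQRep (TypeA.rep2 N e) →
      ∃ i j : Fin (ℓ + 1), i < j ∧ ∑ k, TypeA.tupIJ e i j k ≤ N ∧
        TypeA.Degenerates N (TypeA.repA N (TypeA.tupIJ e i j)) M.toQRep) := by
  refine ⟨fun _ h => ?_, fun h => ?_⟩
  · obtain ⟨p, q, hpq, hq, hc⟩ :=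
      TypeA.exists_corank_of_not_degenerates_rep1 he he_first he_last M h
    obtain ⟨i, hi⟩ := TypeA.exists_arrow_corank he M hpq hq hc
    exact ⟨i, TypeA.degenerates_repA _ M fun p q _ _ => TypeA.arrowSum_tupI_le e M i hi p q⟩
  · obtain ⟨i, j, hij, hle⟩ := TypeA.exists_arrowSum_tupIJ_le he M
      (TypeA.exists_corank_of_not_degenerates_rep2 (by omega) he he_first he_last M h)
    exact ⟨i, j, hij, TypeA.degenerates_repA _ M fun p q _ _ => hle p q⟩
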